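/- Let $S^\infty$ be the Banach space of compact operators on $\ell^2$ (with the operator norm) and $S^1$ the Banach space of trace class operators on $\ell^2$ (with the trace norm $\|T\|_{S^1}=\mathrm{tr}\,|T|$). Let $C_0(\mathbb{R};S^\infty)$ be the space of continuous functions $\mathbb{R}\to S^\infty$ vanishing at infinity, with the supremum norm $\|\cdot\|_\infty$. Let $H^1(\mathbb{R})$ be the space of all $h\in L^1(\mathbb{R})$ such that $\int_{\mathbb{R}} h(t)e^{-itu}\,dt=0$ for all $u\le 0$, and let $H^1(\mathbb{R};S^1)$ be the closure of $H^1(\mathbb{R})\otimes S^1$ in the Bochner space $L^1(\mathbb{R};S^1)$, with the norm $\|\cdot\|_1$ of $L^1(\mathbb{R};S^1)$. For $f\in C_0(\mathbb{R};S^\infty)$ and $h\in H^1(\mathbb{R};S^1)$ put $$(f\ast h)(s)=\int_{-\infty}^{\infty}\mathrm{tr}\bigl(f(t)h(s-t)\bigr)\,dt,\qquad s\in\mathbb{R}.$$ Let $\mathcal{A}_{0,S^1}(\mathbb{R})$ be the space of all functions $F\colon\mathbb{R}\to\mathbb{C}$ for which there exist sequences $(f_k)_{k\ge1}$ in $C_0(\mathbb{R};S^\infty)$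 and $(h_k)_{k\ge1}$ in $H^1(\mathbb{R};S^1)$ such that $$\sum_{k=1}^\infty\|f_k\|_\infty\|h_k\|_1<\infty\qquad\text{and}\qquad F(s)=\sum_{k=1}^\infty (f_k\ast h_k)(s)\quad\text{for all } s\in\mathbb{R},$$ and let $\|F\|_{\mathcal{A}_{0,S^1}}$ be the infimum of $\sum_{k}\|f_k\|_\infty\|h_k\|_1$ over all such pairs of sequences. **Proposition 4.1.** The space $\mathcal{A}_{0,S^1}(\mathbb{R})$ is a Banach algebra for the pointwise multiplication. That is, $\mathcal{A}_{0,S^1}(\mathbb{R})$ is a (not necessarily unital) subalgebra of the algebra of all functions $\mathbb{R}\to\mathbb{C}$, $\|\cdot\|_{\mathcal{A}_{0,S^1}}$ is a norm on it for which it is complete, and $\|FG\|_{\mathcal{A}_{0,S^1}}\le\|F\|_{\mathcal{A}_{0,S^1}}\|G\|_{\mathcal{A}_{0,S^1}}$ for all $F,G\in\mathcal{A}_{0,S^1}(\mathbb{R})$. -/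

import Mathlib

noncomputable section

namespace S1Hardy

section TraceClass

variable {H : Type*} [NormedAddCommGroup H] [InnerProductSpace ℂ H] [CompleteSpace H]
  {ι : Type*}

/-- The operator `T` is trace class when `tr |T| = ∑ i, ⟨|T| b_i, b_i⟩` is finite, where
`|T| = (T* T)^{1/2}` and `b` is a Hilbert basis. -/
def IsTraceClass (b : HilbertBasis ι ℂ H) (T : H →L[ℂ] H) : Prop :=
  Summable fun i => (inner ℂ (b i) (CFC.abs T (b i))).re

/-- The trace norm `tr |T|`. -/
def traceNorm (b : HilbertBasis ι ℂ H) (T : H →L[ℂ] H) : ℝ :=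
  ∑' i, (inner ℂ (b i) (CFC.abs T (b i))).re

/-- The trace `∑ i, ⟨T b_i, b_i⟩`. -/
def trace (b : HilbertBasis ι ℂ H) (T : H →L[ℂ] H) : ℂ :=
  ∑' i, inner ℂ (b i) (T (b i))

theorem norm_abs_apply (T : H →L[ℂ] H) (x : H) : ‖CFC.abs T x‖ = ‖T x‖ := by
  have h : (inner ℂ (CFC.abs T x) (CFC.abs T x)) = (inner ℂ (T x) (T x) : ℂ) := by
    have hs : ContinuousLinearMap.adjoint (CFC.abs T) = CFC.abs T :=
      (CFC.abs_nonneg T).isSelfAdjoint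
    rw [← ContinuousLinearMap.adjoint_inner_left, hs, ← ContinuousLinearMap.adjoint_inner_left T]
    have := congrArg (fun S : H →L[ℂ] H => S x) (CFC.abs_mul_abs T)
    simp only [mul_apply_eq_comp] at this
    rw [this]; rfl
  rw [inner_self_eq_norm_sq_to_K, inner_self_eq_norm_sq_to_K] at h
  have h2 : ‖CFC.abs T x‖ ^ 2 = ‖T x‖ ^ 2 := by exact_mod_cast h
  exact (sq_eq_sq₀ (norm_nonneg _) (norm_nonneg _)).1 h2

theorem exists_polar (T : H →L[ℂ] H) : ∃ U : H →L[ℂ] H, (∀ x, ‖U x‖ ≤ ‖x‖) ∧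
    (∀ x, U (CFC.abs T x) = T x) ∧ ∀ x, ContinuousLinearMap.adjoint U (T x) = CFC.abs T x := by
  let A : H →L[ℂ] H := CFC.abs T
  let K : Submodule ℂ H := (LinearMap.range A.toLinearMap).topologicalClosure
  have : CompleteSpace K :=
    (Submodule.isClosed_topologicalClosure _).completeSpace_coe
  have hmem : ∀ x, A x ∈ K := fun x =>
    Submodule.le_topologicalClosure _ (LinearMap.mem_range_self A.toLinearMap x)
  let e : H →ₗ[ℂ] K := A.toLinearMap.codRestrict K hmem
  have hd : DenseRange e := by
    intro ⟨k, hk⟩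
    rw [Metric.mem_closure_range_iff]
    intro ε hε
    have hk' : k ∈ closure (Set.range A) := hk
    obtain ⟨x, hx⟩ := Metric.mem_closure_range_iff.1 hk' ε hε
    exact ⟨x, hx⟩
  have hn : ∀ x, ‖T.toLinearMap x‖ ≤ 1 * ‖e x‖ := by
    intro x
    rw [one_mul]
    exact (norm_abs_apply T x).ge
  let V : K →L[ℂ] H := T.toLinearMap.extendOfNorm e
  let U : H →L[ℂ] H := V ∘L K.orthogonalProjectionOnto
  have hU : ∀ x, ‖U x‖ ≤ ‖x‖ := by
    intro x
    calc ‖U x‖ ≤ 1 * ‖K.orthogonalProjectionOnto x‖ :=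
          LinearMap.norm_extendOfNorm_apply_le hd 1 hn _
      _ ≤ ‖x‖ := by rw [one_mul]; exact K.norm_orthogonalProjectionOnto_apply_le x
  have hUA : ∀ x, U (A x) = T x := by
    intro x
    have : K.orthogonalProjectionOnto (A x) = e x :=
      K.orthogonalProjectionOnto_mem_subspace_eq_self (e x)
    change V (K.orthogonalProjectionOnto (A x)) = T x
    rw [this]
    exact LinearMap.extendOfNorm_eq hd ⟨1, hn⟩ x
  refine ⟨U, hU, hUA, fun x => ?_⟩
  have hUn : ‖U‖ ≤ 1 := U.opNorm_le_bound zero_le_one (by simpa using hU)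
  have h1 : ‖ContinuousLinearMap.adjoint U (T x)‖ ≤ ‖A x‖ := by
    calc _ ≤ ‖ContinuousLinearMap.adjoint U‖ * ‖T x‖ := ContinuousLinearMap.le_opNorm _ _
      _ ≤ 1 * ‖T x‖ := by
        gcongr
        rw [LinearIsometryEquiv.norm_map]; exact hUn
      _ = ‖A x‖ := by rw [one_mul]; exact (norm_abs_apply T x).symm
  have h2 : (inner ℂ (ContinuousLinearMap.adjoint U (T x)) (A x)).re = ‖A x‖ ^ 2 := by
    rw [ContinuousLinearMap.adjoint_inner_left, hUA, inner_self_eq_norm_sq_to_K,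
      ← norm_abs_apply T x]
    norm_cast
  have h3 := @norm_sub_sq ℂ H _ _ _ (ContinuousLinearMap.adjoint U (T x)) (A x)
  have h4 : ‖ContinuousLinearMap.adjoint U (T x)‖ ^ 2 ≤ ‖A x‖ ^ 2 := by gcongr
  have h5 : RCLike.re (inner ℂ (ContinuousLinearMap.adjoint U (T x)) (A x)) = ‖A x‖ ^ 2 := h2
  rw [h5] at h3
  have h6 : ‖ContinuousLinearMap.adjoint U (T x) - A x‖ ^ 2 ≤ 0 := by linarith
  have h7 : ‖ContinuousLinearMap.adjoint U (T x) - A x‖ = 0 := by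
    have := norm_nonneg (ContinuousLinearMap.adjoint U (T x) - A x)
    nlinarith
  exact sub_eq_zero.1 (norm_eq_zero.1 h7)

theorem inner_abs_nonneg (T : H →L[ℂ] H) (x : H) : 0 ≤ (inner ℂ x (CFC.abs T x)).re :=
  ((ContinuousLinearMap.nonneg_iff_isPositive _).1 (CFC.abs_nonneg T)).re_inner_nonneg_right x

theorem traceNorm_nonneg (b : HilbertBasis ι ℂ H) (T : H →L[ℂ] H) : 0 ≤ traceNorm b T :=
  tsum_nonneg fun i => inner_abs_nonneg T (b i)

/-- A trace class operator is a sum of rank one operators `⟨·, x_i⟩ y_i` with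
`∑ ‖x_i‖ ‖y_i‖ ≤ tr |T|`. -/
theorem IsTraceClass.exists_nuclear {b : HilbertBasis ι ℂ H} {T : H →L[ℂ] H}
    (hT : IsTraceClass b T) : ∃ x y : ι → H, (Summable fun i => ‖x i‖ * ‖y i‖) ∧
      ∑' i, ‖x i‖ * ‖y i‖ ≤ traceNorm b T ∧
      ∀ v, HasSum (fun i => (inner ℂ (x i) v : ℂ) • y i) (T v) := by
  obtain ⟨U, hU, hUA, -⟩ := exists_polar T
  let S : H →L[ℂ] H := CFC.sqrt (CFC.abs T)
  have hS : ContinuousLinearMap.adjoint S = S := (CFC.sqrt_nonneg (CFC.abs T)).isSelfAdjoint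
  have hSS : ∀ v, S (S v) = CFC.abs T v := fun v =>
    congrArg (fun R : H →L[ℂ] H => R v) (CFC.sqrt_mul_sqrt_self (CFC.abs T) (CFC.abs_nonneg T))
  have hsym : ∀ v w, (inner ℂ (S v) w : ℂ) = inner ℂ v (S w) := by
    intro v w
    rw [← ContinuousLinearMap.adjoint_inner_left, hS]
  have hle : ∀ i, ‖S (b i)‖ * ‖U (S (b i))‖ ≤ (inner ℂ (b i) (CFC.abs T (b i))).re := by
    intro i
    rw [← hSS, ← hsym, inner_self_eq_norm_sq_to_K]
    have h1 : ‖S (b i)‖ * ‖U (S (b i))‖ ≤ ‖S (b i)‖ * ‖S (b i)‖ := by gcongr; exact hU _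
    have h2 : (((‖S (b i)‖ : ℂ)) ^ 2).re = ‖S (b i)‖ * ‖S (b i)‖ := by
      norm_cast; ring
    exact h1.trans h2.ge
  have hs : Summable fun i => ‖S (b i)‖ * ‖U (S (b i))‖ :=
    Summable.of_nonneg_of_le (fun i => by positivity) hle hT
  refine ⟨fun i => S (b i), fun i => U (S (b i)), hs, hs.tsum_le_tsum hle hT, fun v => ?_⟩
  have h := (b.hasSum_repr (S v)).mapL (U ∘L S)
  simpa only [ContinuousLinearMap.comp_apply, map_smul, hSS, hUA, b.repr_apply_apply, ← hsym]
    using h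

/-- Conversely, an absolutely convergent sum of rank one operators is trace class. -/
theorem IsTraceClass.of_nuclear (b : HilbertBasis ι ℂ H) {T : H →L[ℂ] H} {κ : Type*}
    {x y : κ → H} (hs : Summable fun k => ‖x k‖ * ‖y k‖)
    (hT : ∀ v, HasSum (fun k => (inner ℂ (x k) v : ℂ) • y k) (T v)) :
    IsTraceClass b T ∧ traceNorm b T ≤ ∑' k, ‖x k‖ * ‖y k‖ := by
  obtain ⟨U, hU, -, hUT⟩ := exists_polar T
  have hU' : ∀ v, ‖ContinuousLinearMap.adjoint U v‖ ≤ ‖v‖ := by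
    intro v
    have hUn : ‖U‖ ≤ 1 := U.opNorm_le_bound zero_le_one (by simpa using hU)
    calc _ ≤ ‖ContinuousLinearMap.adjoint U‖ * ‖v‖ := ContinuousLinearMap.le_opNorm _ _
      _ ≤ 1 * ‖v‖ := by
        gcongr
        rw [LinearIsometryEquiv.norm_map]; exact hUn
      _ = ‖v‖ := one_mul _
  let z : κ → H := fun k => ContinuousLinearMap.adjoint U (y k)
  have habs : ∀ v, HasSum (fun k => (inner ℂ (x k) v : ℂ) • z k) (CFC.abs T v) := by
    intro v
    have h := (hT v).mapL (ContinuousLinearMap.adjoint U)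
    rw [hUT] at h
    simpa [z] using h
  have hin : ∀ v, HasSum (fun k => ((inner ℂ (x k) v : ℂ) * inner ℂ v (z k)).re)
      (inner ℂ v (CFC.abs T v)).re := by
    intro v
    have h := ((habs v).mapL (innerSL ℂ v)).mapL Complex.reCLM
    simpa [inner_smul_right] using h
  have key : ∀ s : Finset ι, ∀ p q : H,
      ∑ i ∈ s, ((inner ℂ p (b i) : ℂ) * inner ℂ (b i) q).re ≤ ‖p‖ * ‖q‖ := by
    intro s p q
    have h1 : ∑ i ∈ s, ((inner ℂ p (b i) : ℂ) * inner ℂ (b i) q).re ≤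
        ∑ i ∈ s, ‖(inner ℂ (b i) p : ℂ)‖ * ‖(inner ℂ (b i) q : ℂ)‖ := by
      refine Finset.sum_le_sum fun i _ => (Complex.re_le_norm _).trans ?_
      rw [norm_mul, norm_inner_symm]
    refine h1.trans ((Real.sum_mul_le_sqrt_mul_sqrt _ _ _).trans ?_)
    gcongr
    · exact Real.sqrt_le_left (norm_nonneg _) |>.2 (b.orthonormal.sum_inner_products_le p) 
    · exact Real.sqrt_le_left (norm_nonneg _) |>.2 (b.orthonormal.sum_inner_products_le q) 
  have hfin : ∀ s : Finset ι, ∑ i ∈ s, (inner ℂ (b i) (CFC.abs T (b i))).re ≤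
      ∑' k, ‖x k‖ * ‖y k‖ := by
    intro s
    have h := hasSum_sum (s := s) (fun i _ => hin (b i))
    refine hasSum_le (fun k => ?_) h hs.hasSum
    refine (key s (x k) (z k)).trans ?_
    gcongr
    exact hU' _
  have hsum : IsTraceClass b T :=
    summable_of_sum_le (fun i => inner_abs_nonneg T (b i)) hfin
  exact ⟨hsum, hsum.tsum_le_of_sum_le hfin⟩

theorem IsTraceClass.zero (b : HilbertBasis ι ℂ H) : IsTraceClass b (0 : H →L[ℂ] H) := by
  simp [IsTraceClass, CFC.abs_zero, summable_zero]

theorem IsTraceClass.add {b : HilbertBasis ι ℂ H} {S T : H →L[ℂ] H} (hS : IsTraceClass b S)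
    (hT : IsTraceClass b T) :
    IsTraceClass b (S + T) ∧ traceNorm b (S + T) ≤ traceNorm b S + traceNorm b T := by
  obtain ⟨x, y, h1, h2, h3⟩ := hS.exists_nuclear
  obtain ⟨x', y', h1', h2', h3'⟩ := hT.exists_nuclear
  have hs : HasSum (fun k : ι ⊕ ι => ‖Sum.elim x x' k‖ * ‖Sum.elim y y' k‖)
      (∑' i, ‖x i‖ * ‖y i‖ + ∑' i, ‖x' i‖ * ‖y' i‖) :=
    HasSum.sum (f := fun k : ι ⊕ ι => ‖Sum.elim x x' k‖ * ‖Sum.elim y y' k‖)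
      h1.hasSum h1'.hasSum
  obtain ⟨h4, h5⟩ := IsTraceClass.of_nuclear b (T := S + T) hs.summable
    (fun v => HasSum.sum
      (f := fun k : ι ⊕ ι => (inner ℂ (Sum.elim x x' k) v : ℂ) • Sum.elim y y' k)
      (h3 v) (h3' v))
  rw [hs.tsum_eq] at h5
  exact ⟨h4, h5.trans (add_le_add h2 h2')⟩

theorem abs_smul_inner (b : HilbertBasis ι ℂ H) (c : ℂ) (T : H →L[ℂ] H) (i : ι) :
    (inner ℂ (b i) (CFC.abs (c • T) (b i))).re =
      ‖c‖ * (inner ℂ (b i) (CFC.abs T (b i))).re := by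
  have : CFC.abs (c • T) = ‖c‖ • CFC.abs T := CFC.abs_smul c T
  rw [this]
  simp [inner_smul_right_eq_smul]

theorem IsTraceClass.smul {b : HilbertBasis ι ℂ H} {T : H →L[ℂ] H} (hT : IsTraceClass b T)
    (c : ℂ) : IsTraceClass b (c • T) := by
  simpa only [IsTraceClass, abs_smul_inner] using Summable.mul_left ‖c‖ hT

theorem traceNorm_smul (b : HilbertBasis ι ℂ H) (c : ℂ) (T : H →L[ℂ] H) :
    traceNorm b (c • T) = ‖c‖ * traceNorm b T := by
  simp only [traceNorm, abs_smul_inner, tsum_mul_left]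

theorem IsTraceClass.eq_zero {b : HilbertBasis ι ℂ H} {T : H →L[ℂ] H} (hT : IsTraceClass b T)
    (h0 : traceNorm b T = 0) : T = 0 := by
  obtain ⟨x, y, h1, h2, h3⟩ := hT.exists_nuclear
  rw [h0] at h2
  have hz : ∀ i, ‖x i‖ * ‖y i‖ = 0 := by
    have h4 : ∑' i, ‖x i‖ * ‖y i‖ = 0 :=
      le_antisymm h2 (tsum_nonneg fun i => by positivity)
    have := (hasSum_zero_iff_of_nonneg (fun i => by positivity)).1 (h4 ▸ h1.hasSum)
    exact fun i => congrFun this i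
  ext v
  refine (h3 v).unique ?_
  have : (fun i => (inner ℂ (x i) v : ℂ) • y i) = fun _ => 0 := by
    funext i
    rcases mul_eq_zero.1 (hz i) with h | h
    · simp [norm_eq_zero.1 h]
    · simp [norm_eq_zero.1 h]
  rw [this]
  exact hasSum_zero

/-- The trace class operators as a linear subspace of all bounded operators. -/
def traceClassSubmodule (b : HilbertBasis ι ℂ H) : Submodule ℂ (H →L[ℂ] H) where
  carrier := {T | IsTraceClass b T}
  add_mem' hS hT := (IsTraceClass.add hS hT).1
  zero_mem' := IsTraceClass.zero b
  smul_mem' c _ hT := IsTraceClass.smul hT c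

/-- The space of trace class operators, to be normed by the trace norm (this is a copy of the
subspace, so that it does not carry the operator norm). -/
def TraceClass (b : HilbertBasis ι ℂ H) : Type _ := traceClassSubmodule b

variable (b : HilbertBasis ι ℂ H)

instance : AddCommGroup (TraceClass b) := inferInstanceAs (AddCommGroup (traceClassSubmodule b))

instance : Module ℂ (TraceClass b) := inferInstanceAs (Module ℂ (traceClassSubmodule b))

/-- The bounded operator underlying a trace class operator. -/
def TraceClass.toCLM {b : HilbertBasis ι ℂ H} (T : TraceClass b) : H →L[ℂ] H := T.1

instance : Norm (TraceClass b) := ⟨fun T => traceNorm b T.toCLM⟩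

theorem TraceClass.normCore : NormedSpace.Core ℂ (TraceClass b) where
  norm_nonneg T := traceNorm_nonneg b T.toCLM
  norm_smul c T := traceNorm_smul b c T.toCLM
  norm_triangle S T := (IsTraceClass.add S.2 T.2).2
  norm_eq_zero_iff T := by
    refine ⟨fun h => Subtype.ext (IsTraceClass.eq_zero T.2 h), fun h => ?_⟩
    subst h
    change traceNorm b (0 : H →L[ℂ] H) = 0
    simp [traceNorm, CFC.abs_zero]

instance : NormedAddCommGroup (TraceClass b) := NormedAddCommGroup.ofCore (TraceClass.normCore b)

instance : NormedSpace ℂ (TraceClass b) := NormedSpace.ofCore (TraceClass.normCore b)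

end TraceClass

open MeasureTheory
open scoped ZeroAtInfty

/-- The Hilbert space `ℓ²` of square summable complex sequences. -/
abbrev Ell2 : Type := lp (fun _ : ℕ => ℂ) 2

/-- The standard basis of `ℓ²`. -/
def stdBasis : HilbertBasis ℕ ℂ Ell2 := HilbertBasis.ofRepr (LinearIsometryEquiv.refl ℂ Ell2)

/-- `S^∞`: the compact operators on `ℓ²`, with the operator norm. -/
abbrev SInf : Type := compactOperator (RingHom.id ℂ) Ell2 Ell2

/-- `S^1`: the trace class operators on `ℓ²`, with the trace norm. -/
abbrev SOne : Type := TraceClass stdBasis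

/-- `H^1(ℝ)`: the classes `h` in `L^1(ℝ)` with `∫ h(t) e^{-itu} dt = 0` for all `u ≤ 0`. -/
def hardyScalar : Set (Lp ℂ 1 (volume : Measure ℝ)) :=
  {h | ∀ u : ℝ, u ≤ 0 → ∫ t : ℝ, h t * Complex.exp (-(Complex.I * t * u)) = 0}

/-- `H^1(ℝ; Z)`: the closure in `L^1(ℝ; Z)` of the linear span `H^1(ℝ) ⊗ Z` of the functions
`t ↦ g(t) z` with `g ∈ H^1(ℝ)` and `z ∈ Z`. -/
def hardy (Z : Type*) [NormedAddCommGroup Z] [NormedSpace ℂ Z] :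
    Submodule ℂ (Lp Z 1 (volume : Measure ℝ)) :=
  (Submodule.span ℂ {h : Lp Z 1 (volume : Measure ℝ) |
    ∃ g ∈ hardyScalar, ∃ z : Z, h =ᵐ[volume] fun t => g t • z}).topologicalClosure

/-- `(f ∗ h)(s) = ∫ tr(f(t) h(s - t)) dt`. -/
def conv (f : C₀(ℝ, SInf)) (h : hardy SOne) (s : ℝ) : ℂ :=
  ∫ t : ℝ, trace stdBasis ((f t : Ell2 →L[ℂ] Ell2) ∘L ((h : Lp SOne 1 volume) (s - t)).toCLM)

/-- The sequences `f_k` and `h_k` satisfy `∑ ‖f_k‖ ‖h_k‖ < ∞` and `F(s) = ∑ (f_k ∗ h_k)(s)` for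
every `s`. -/
def Represents (F : ℝ → ℂ) (f : ℕ → C₀(ℝ, SInf)) (h : ℕ → hardy SOne) : Prop :=
  (Summable fun k => ‖f k‖ * ‖h k‖) ∧ ∀ s, HasSum (fun k => conv (f k) (h k) s) (F s)

/-- The space `𝒜_{0,S^1}(ℝ)`. -/
def A0 : Set (ℝ → ℂ) := {F | ∃ f h, Represents F f h}

/-- The norm of `𝒜_{0,S^1}(ℝ)`: the infimum of `∑ ‖f_k‖ ‖h_k‖` over all representations. -/
def A0norm (F : ℝ → ℂ) : ℝ :=
  sInf {r | ∃ f h, Represents F f h ∧ r = ∑' k, ‖f k‖ * ‖h k‖}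

end S1Hardy
end

/-!
The proof rests on a product formula. With `S^∞` and `S^1` paired by the trace, changing variables
in the product of two convolutions gives
`(f₁ ∗ h₁) (f₂ ∗ h₂) = ∫ (f₁ ⊗ f₂(· + r)) ∗ (h₁ ⊗ h₂(· - r)) dr`,
where `A ⊗ B` is the tensor product of operators on `ℓ²`, transported along an isometry
`ℓ² ⊗ ℓ² ≅ ℓ²`. It is multiplicative for the trace pairing (`tracePairing_tens`) and contractive on
compact operators (`norm_compactTensL_le`) and on trace class operators (`norm_traceTensL_le`).

To turn the integral over `r` into a series, the translates `f₂(· + r)`, which depend uniformly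
continuously on `r`, are written as a sum of step functions `∑ 1_{A_q}(r) D_q` whose norms add up
to at most `‖f₂‖ + ε` at every `r` (`exists_step_decomposition`). The product is then the sum over
`q` of the convolutions of `f₁ ⊗ D_q` with the averages `t ↦ ∫_{A_q} h₁(t) ⊗ h₂(t - r) dr`
(`hasSum_pairConv_average`), at a total cost of at most `‖f₁‖ (‖f₂‖ + ε) ‖h₁‖ ‖h₂‖`. The averages
belong to `H¹` (`averageLp_mem_hardy`), because `t ↦ h₁(t) h₂(t - r)` does for almost every `r` when
`h₁` and `h₂` are scalar (`integral_mul_average_expChar`). This is the support property of the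
convolution of two Fourier transforms, with one more Fourier transform, in `r`, to make it
meaningful for products of integrable functions.

Everything else follows from the countable subadditivity of the costs of representations
(`CostLE.hasSum`): it yields the triangle inequality, completeness (applied to the tails of an
absolutely convergent series), and, with the product formula, submultiplicativity.
-/

noncomputable section

namespace S1Hardy

open scoped TensorProduct InnerProductSpace

/-! ### Tensor products of operators on inner product spaces -/

section AlgebraicTensor

variable {H : Type*} [NormedAddCommGroup H] [InnerProductSpace ℂ H] [CompleteSpace H]

theorem inner_map_adjoint (A B : H →L[ℂ] H) (x y : H ⊗[ℂ] H) :
    (inner ℂ (TensorProduct.map A.toLinearMap B.toLinearMap x) y : ℂ) =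
      inner ℂ x (TensorProduct.map (ContinuousLinearMap.adjoint A).toLinearMap
        (ContinuousLinearMap.adjoint B).toLinearMap y) := by
  induction x with
  | zero => simp
  | add x x' hx hx' => simp only [map_add, inner_add_left, hx, hx']
  | tmul u v =>
    induction y with
    | zero => simp
    | add y y' hy hy' => simp only [map_add, inner_add_right, hy, hy']
    | tmul u' v' =>
      simp [ContinuousLinearMap.adjoint_inner_right]

/-- The defect `‖B‖² - B* B` of a bounded operator is of the form `C* C`. -/
theorem exists_defect (B : H →L[ℂ] H) : ∃ C : H →L[ℂ] H,
    ∀ v, ContinuousLinearMap.adjoint C (C v) + ContinuousLinearMap.adjoint B (B v) =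
      ((‖B‖ : ℂ) ^ 2) • v := by
  let D : H →L[ℂ] H := ((‖B‖ : ℂ) ^ 2) • 1 - ContinuousLinearMap.adjoint B ∘L B
  have hD : 0 ≤ D := by
    rw [ContinuousLinearMap.nonneg_iff_isPositive]
    refine (ContinuousLinearMap.isPositive_iff_complex D).2 fun x => ?_
    have h1 : (inner ℂ (D x) x : ℂ) = ((‖B‖ ^ 2 * ‖x‖ ^ 2 - ‖B x‖ ^ 2 : ℝ) : ℂ) := by
      simp only [D, sub_apply, inner_sub_left, smul_apply,
        ContinuousLinearMap.comp_apply, ContinuousLinearMap.adjoint_inner_left,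
        inner_smul_left, inner_self_eq_norm_sq_to_K, one_apply_eq_self]
      simp
    rw [h1]
    refine ⟨by rw [RCLike.re_to_complex, Complex.ofReal_re], ?_⟩
    have := B.le_opNorm x
    have h2 : ‖B x‖ ^ 2 ≤ (‖B‖ * ‖x‖) ^ 2 := by gcongr
    rw [RCLike.re_to_complex, Complex.ofReal_re]
    nlinarith
  refine ⟨CFC.sqrt D, fun v => ?_⟩
  have hS : ContinuousLinearMap.adjoint (CFC.sqrt D) = CFC.sqrt D :=
    (CFC.sqrt_nonneg D).isSelfAdjoint
  have hSS : CFC.sqrt D (CFC.sqrt D v) = D v :=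
    congrArg (fun R : H →L[ℂ] H => R v) (CFC.sqrt_mul_sqrt_self D hD)
  rw [hS, hSS]
  simp [D]

/-- With `C` the defect of `B`, the squared norms of `(1 ⊗ B) x` and `(1 ⊗ C) x` add up to
`‖B‖² ‖x‖²`. -/
theorem norm_map_id_le (B : H →L[ℂ] H) (x : H ⊗[ℂ] H) :
    ‖TensorProduct.map (ContinuousLinearMap.id ℂ H).toLinearMap B.toLinearMap x‖ ≤
      ‖B‖ * ‖x‖ := by
  obtain ⟨C, hC⟩ := exists_defect B
  have hsq : ∀ B : H →L[ℂ] H, (‖TensorProduct.map (ContinuousLinearMap.id ℂ H).toLinearMap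
      B.toLinearMap x‖ : ℂ) ^ 2 = inner ℂ x
        (TensorProduct.map (ContinuousLinearMap.id ℂ H).toLinearMap
          (ContinuousLinearMap.adjoint B ∘L B).toLinearMap x) := by
    intro B
    have h := inner_self_eq_norm_sq_to_K (𝕜 := ℂ)
      (TensorProduct.map (ContinuousLinearMap.id ℂ H).toLinearMap B.toLinearMap x)
    rw [inner_map_adjoint] at h
    rw [← LinearMap.comp_apply, ← TensorProduct.map_comp] at h
    refine h.symm.trans ?_
    have : ContinuousLinearMap.adjoint (ContinuousLinearMap.id ℂ H)
        = ContinuousLinearMap.id ℂ H := ContinuousLinearMap.adjoint_id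
    rw [this]
    rfl
  have hsum : TensorProduct.map (ContinuousLinearMap.id ℂ H).toLinearMap
        (ContinuousLinearMap.adjoint C ∘L C).toLinearMap +
      TensorProduct.map (ContinuousLinearMap.id ℂ H).toLinearMap
        (ContinuousLinearMap.adjoint B ∘L B).toLinearMap =
      ((‖B‖ : ℂ) ^ 2) • LinearMap.id := by
    refine TensorProduct.ext' fun u v => ?_
    simp [← TensorProduct.tmul_add, hC]
  have h := congrArg (fun R => (inner ℂ x (R x) : ℂ)) hsum
  simp only [LinearMap.add_apply, inner_add_right, ← hsq, LinearMap.smul_apply,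
    inner_smul_right, LinearMap.id_apply, inner_self_eq_norm_sq_to_K] at h
  have h' : ‖TensorProduct.map (ContinuousLinearMap.id ℂ H).toLinearMap C.toLinearMap x‖ ^ 2 +
      ‖TensorProduct.map (ContinuousLinearMap.id ℂ H).toLinearMap B.toLinearMap x‖ ^ 2 =
      ‖B‖ ^ 2 * ‖x‖ ^ 2 := by
    apply Complex.ofReal_injective
    push_cast
    exact h
  refine le_of_sq_le_sq ?_ (by positivity)
  rw [mul_pow, ← h']
  exact le_add_of_nonneg_left (by positivity)

theorem norm_map_le (A B : H →L[ℂ] H) (x : H ⊗[ℂ] H) :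
    ‖TensorProduct.map A.toLinearMap B.toLinearMap x‖ ≤ ‖A‖ * ‖B‖ * ‖x‖ := by
  have h1 : TensorProduct.map A.toLinearMap B.toLinearMap x =
      TensorProduct.comm ℂ H H (TensorProduct.map (ContinuousLinearMap.id ℂ H).toLinearMap
        A.toLinearMap (TensorProduct.comm ℂ H H
          (TensorProduct.map (ContinuousLinearMap.id ℂ H).toLinearMap B.toLinearMap x))) := by
    induction x with
    | zero => simp
    | add x y hx hy => simp only [map_add, hx, hy]
    | tmul u v => simp
  rw [h1, TensorProduct.norm_comm]
  refine (norm_map_id_le A _).trans ?_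
  rw [TensorProduct.norm_comm, mul_assoc]
  gcongr
  exact norm_map_id_le B x

end AlgebraicTensor

/-! ### The tensor product of a Hilbert space with itself, realized on that space -/

section HilbertTensor

variable {H : Type*} [NormedAddCommGroup H] [InnerProductSpace ℂ H]

/-- The Hilbert space tensor product of `H` with itself. -/
abbrev HilbertTensor (H : Type*) [NormedAddCommGroup H] [InnerProductSpace ℂ H] : Type _ :=
  UniformSpace.Completion (H ⊗[ℂ] H)

variable (b : HilbertBasis ℕ ℂ H)

/-- The vectors `b_i ⊗ b_j`, with `(i, j)` enumerated by the pairing function. -/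
def tensorVec (n : ℕ) : HilbertTensor H :=
  ((b n.unpair.1 ⊗ₜ[ℂ] b n.unpair.2 : H ⊗[ℂ] H) : HilbertTensor H)

theorem orthonormal_tensorVec : Orthonormal ℂ (tensorVec b) := by
  classical
  rw [orthonormal_iff_ite]
  intro m n
  have h := (orthonormal_iff_ite (𝕜 := ℂ)).1 b.orthonormal
  simp only [tensorVec, UniformSpace.Completion.inner_coe, TensorProduct.inner_tmul, h]
  by_cases hmn : m = n
  · simp [hmn]
  · by_cases h1 : m.unpair.1 = n.unpair.1
    · have h2 : m.unpair.2 ≠ n.unpair.2 := fun h2 =>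
        hmn (by rw [← Nat.pair_unpair m, ← Nat.pair_unpair n, h1, h2])
      simp [hmn, h2]
    · simp [hmn, h1]

/-- A closed subspace containing `φ (b_i) (b_j)` contains `φ u v`, for `φ` bounded bilinear. -/
theorem bilin_mem_of_basis {G : Type*} [NormedAddCommGroup G] [NormedSpace ℂ G]
    (φ : H →L[ℂ] H →L[ℂ] G) (K : Submodule ℂ G) (hK : IsClosed (K : Set G))
    (h : ∀ i j, φ (b i) (b j) ∈ K) (u v : H) : φ u v ∈ K := by
  have key : ∀ (ψ : H →L[ℂ] G), (∀ i, ψ (b i) ∈ K) → ∀ u, ψ u ∈ K := by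
    intro ψ hψ u
    have hle : (⊤ : Submodule ℂ H) ≤ K.comap ψ.toLinearMap := by
      rw [← b.dense_span]
      refine Submodule.topologicalClosure_minimal _ ?_ (hK.preimage ψ.continuous)
      rw [Submodule.span_le]
      rintro _ ⟨i, rfl⟩
      exact hψ i
    exact hle (Submodule.mem_top (x := u))
  exact key (φ u) (fun j => key (φ.flip (b j)) (fun i => h i j) u) v

theorem dense_span_tensorVec :
    ⊤ ≤ (Submodule.span ℂ (Set.range (tensorVec b))).topologicalClosure := by
  set K := (Submodule.span ℂ (Set.range (tensorVec b))).topologicalClosure with hKdef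
  have hK : IsClosed (K : Set (HilbertTensor H)) := Submodule.isClosed_topologicalClosure _
  have h1 : ∀ u v : H, ((u ⊗ₜ[ℂ] v : H ⊗[ℂ] H) : HilbertTensor H) ∈ K := by
    let φ : H →L[ℂ] H →L[ℂ] HilbertTensor H :=
      (ContinuousLinearMap.compL ℂ H (H ⊗[ℂ] H) (HilbertTensor H)
        UniformSpace.Completion.toComplL) ∘L TensorProduct.mkL ℂ H H
    refine bilin_mem_of_basis b φ K hK fun i j => ?_
    refine Submodule.le_topologicalClosure _ (Submodule.subset_span ⟨Nat.pair i j, ?_⟩)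
    simp [tensorVec, φ]
  intro x _
  refine UniformSpace.Completion.induction_on x hK fun a => ?_
  induction a with
  | zero => rw [UniformSpace.Completion.coe_zero]; exact K.zero_mem
  | add a b ha hb => rw [UniformSpace.Completion.coe_add]; exact K.add_mem ha hb
  | tmul u v => exact h1 u v

/-- The orthonormal basis `b_i ⊗ b_j` of `H ⊗ H`. -/
def tensorBasis : HilbertBasis ℕ ℂ (HilbertTensor H) :=
  HilbertBasis.mk (orthonormal_tensorVec b) (dense_span_tensorVec b)

/-- The isometry from the algebraic tensor product `H ⊗ H` to `H` that sends the basis `b_i ⊗ b_j`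
to the basis `b`. -/
def tensorIso : H ⊗[ℂ] H →ₗᵢ[ℂ] H :=
  ((tensorBasis b).repr.trans b.repr.symm).toLinearIsometry.comp UniformSpace.Completion.toComplₗᵢ

theorem denseRange_tensorIso : DenseRange (tensorIso b) :=
  ((tensorBasis b).repr.trans b.repr.symm).surjective.denseRange.comp
    UniformSpace.Completion.denseRange_coe ((tensorBasis b).repr.trans b.repr.symm).continuous

theorem tensorIso_basis (i j : ℕ) : tensorIso b (b i ⊗ₜ b j) = b (Nat.pair i j) := by
  classical
  have h : ((b i ⊗ₜ[ℂ] b j : H ⊗[ℂ] H) : HilbertTensor H) = tensorBasis b (Nat.pair i j) := by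
    rw [tensorBasis, HilbertBasis.coe_mk]
    simp [tensorVec]
  have h2 : tensorIso b (b i ⊗ₜ b j) = b.repr.symm ((tensorBasis b).repr
      ((b i ⊗ₜ[ℂ] b j : H ⊗[ℂ] H) : HilbertTensor H)) := rfl
  rw [h2, h, (tensorBasis b).repr_self, b.repr_symm_single]

/-- The tensor product `u ⊗ v`, as an element of `H`. -/
def tens (u v : H) : H := tensorIso b (u ⊗ₜ v)

theorem inner_tens (u v u' v' : H) :
    (inner ℂ (tens b u v) (tens b u' v') : ℂ) = inner ℂ u u' * inner ℂ v v' := by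
  rw [tens, tens, (tensorIso b).inner_map_map, TensorProduct.inner_tmul]

theorem norm_tens (u v : H) : ‖tens b u v‖ = ‖u‖ * ‖v‖ := by
  rw [tens, (tensorIso b).norm_map, TensorProduct.norm_tmul]

theorem basis_eq_tens (n : ℕ) : b n = tens b (b n.unpair.1) (b n.unpair.2) := by
  rw [tens, tensorIso_basis, Nat.pair_unpair]

theorem tens_add_left (u u' v : H) : tens b (u + u') v = tens b u v + tens b u' v := by
  simp [tens, TensorProduct.add_tmul]

theorem tens_add_right (u v v' : H) : tens b u (v + v') = tens b u v + tens b u v' := by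
  simp [tens, TensorProduct.tmul_add]

theorem tens_smul_left (c : ℂ) (u v : H) : tens b (c • u) v = c • tens b u v := by
  rw [tens, tens, ← TensorProduct.smul_tmul', map_smul]

theorem tens_smul_right (c : ℂ) (u v : H) : tens b u (c • v) = c • tens b u v := by
  simp [tens]

/-- The tensor product of vectors as a bounded bilinear map. -/
def tensL : H →L[ℂ] H →L[ℂ] H :=
  LinearMap.mkContinuous₂ (LinearMap.mk₂ ℂ (tens b) (tens_add_left b) (tens_smul_left b)
    (tens_add_right b) (tens_smul_right b)) 1 (fun u v => by simp [norm_tens])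

theorem tensL_apply (u v : H) : tensL b u v = tens b u v := rfl

/-- Bounded operators that agree on the vectors `u ⊗ v` are equal. -/
theorem ext_tens {G : Type*} [NormedAddCommGroup G] [NormedSpace ℂ G] {S T : H →L[ℂ] G}
    (h : ∀ u v, S (tens b u v) = T (tens b u v)) : S = T := by
  have h1 : (S : H → G) ∘ tensorIso b = T ∘ tensorIso b := by
    funext x
    induction x with
    | zero => simp
    | add x y hx hy => simp only [Function.comp_apply, map_add] at hx hy ⊢; rw [hx, hy]
    | tmul u v => exact h u v
  exact ContinuousLinearMap.coeFn_injective
    ((denseRange_tensorIso b).equalizer S.continuous T.continuous h1)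

variable [CompleteSpace H]

/-- The tensor product `A ⊗ B` of bounded operators on `H`, acting on `H ≃ H ⊗ H`. -/
def opTens (A B : H →L[ℂ] H) : H →L[ℂ] H :=
  ((tensorIso b).toLinearMap ∘ₗ TensorProduct.map A.toLinearMap B.toLinearMap).extendOfNorm
    (tensorIso b).toLinearMap

theorem opTens_bound (A B : H →L[ℂ] H) (x : H ⊗[ℂ] H) :
    ‖((tensorIso b).toLinearMap ∘ₗ TensorProduct.map A.toLinearMap B.toLinearMap) x‖ ≤
      ‖A‖ * ‖B‖ * ‖(tensorIso b).toLinearMap x‖ := by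
  simpa using norm_map_le A B x

theorem opTens_tens (A B : H →L[ℂ] H) (u v : H) :
    opTens b A B (tens b u v) = tens b (A u) (B v) :=
  LinearMap.extendOfNorm_eq (denseRange_tensorIso b) ⟨_, opTens_bound b A B⟩ (u ⊗ₜ v)

theorem norm_opTens_le (A B : H →L[ℂ] H) : ‖opTens b A B‖ ≤ ‖A‖ * ‖B‖ :=
  LinearMap.opNorm_extendOfNorm_le (denseRange_tensorIso b) (by positivity) (opTens_bound b A B)

theorem opTens_comp (A B S T : H →L[ℂ] H) :
    opTens b A B ∘L opTens b S T = opTens b (A ∘L S) (B ∘L T) :=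
  ext_tens b fun u v => by simp [opTens_tens]

/-- The tensor product of operators as a bounded bilinear map. -/
def opTensL : (H →L[ℂ] H) →L[ℂ] (H →L[ℂ] H) →L[ℂ] (H →L[ℂ] H) :=
  LinearMap.mkContinuous₂ (LinearMap.mk₂ ℂ (opTens b)
    (fun A A' B => ext_tens b fun u v => by simp [opTens_tens, tens_add_left])
    (fun c A B => ext_tens b fun u v => by simp [opTens_tens, tens_smul_left])
    (fun A B B' => ext_tens b fun u v => by simp [opTens_tens, tens_add_right])
    (fun c A B => ext_tens b fun u v => by simp [opTens_tens, tens_smul_right])) 1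
    (fun A B => by simpa using norm_opTens_le b A B)

/-! ### Tensor products of compact operators -/

omit [CompleteSpace H] in
theorem exists_finiteDimensional_approx {A : H →L[ℂ] H} (hA : IsCompactOperator A) {ε : ℝ}
    (hε : 0 < ε) : ∃ A' : H →L[ℂ] H, ∃ V : Submodule ℂ H, FiniteDimensional ℂ V ∧
      (∀ x, A' x ∈ V) ∧ ‖A - A'‖ ≤ ε := by
  have hc : IsCompact (closure (A '' Metric.closedBall 0 1)) :=
    IsCompactOperator.isCompact_closure_image_closedBall (f := A.toLinearMap) hA 1
  obtain ⟨t, ht, hcov⟩ := Metric.totallyBounded_iff.1 hc.totallyBounded ε hε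
  let V := Submodule.span ℂ t
  have : FiniteDimensional ℂ V := FiniteDimensional.span_of_finite ℂ ht
  refine ⟨V.starProjection ∘L A, V, this, fun x => V.starProjection_apply_mem _, ?_⟩
  refine ContinuousLinearMap.opNorm_le_of_unit_norm hε.le fun x hx => ?_
  have hmem : A x ∈ closure (A '' Metric.closedBall 0 1) :=
    subset_closure ⟨x, by simp [hx], rfl⟩
  obtain ⟨y, hy, hxy⟩ := Set.mem_iUnion₂.1 (hcov hmem)
  have h1 : ‖A x - V.starProjection (A x)‖ ≤ ‖A x - y‖ := by
    rw [V.starProjection_minimal]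
    exact ciInf_le ⟨0, by rintro _ ⟨w, rfl⟩; positivity⟩ (⟨y, Submodule.subset_span hy⟩ : V)
  refine h1.trans ?_
  rw [← dist_eq_norm]
  exact (Metric.mem_ball.1 hxy).le

omit [CompleteSpace H] in
theorem isCompactOperator_of_finiteDimensional {A : H →L[ℂ] H} {V : Submodule ℂ H}
    [FiniteDimensional ℂ V] (hV : ∀ x, A x ∈ V) : IsCompactOperator A := by
  have : ProperSpace V := FiniteDimensional.proper ℂ V
  exact (isCompactOperator_of_locallyCompactSpace_rng V.subtypeL).comp_clm (A.codRestrict V hV)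

theorem opTens_finiteDimensional {A B : H →L[ℂ] H} {V W : Submodule ℂ H}
    [FiniteDimensional ℂ V] [FiniteDimensional ℂ W] (hV : ∀ x, A x ∈ V) (hW : ∀ x, B x ∈ W) :
    IsCompactOperator (opTens b A B) := by
  let F : Submodule ℂ H :=
    LinearMap.range ((tensorIso b).toLinearMap ∘ₗ TensorProduct.mapIncl V W)
  refine isCompactOperator_of_finiteDimensional (V := F) fun x => ?_
  have hF : IsClosed (F : Set H) := F.closed_of_finiteDimensional
  refine (denseRange_tensorIso b).induction_on (p := fun x => opTens b A B x ∈ F) x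
    (hF.preimage (opTens b A B).continuous) fun a => ?_
  induction a with
  | zero => simp
  | add a b ha hb => rw [map_add, map_add]; exact F.add_mem ha hb
  | tmul u v =>
    refine ⟨(⟨A u, hV u⟩ : V) ⊗ₜ (⟨B v, hW v⟩ : W), ?_⟩
    exact (opTens_tens b A B u v).symm

omit [CompleteSpace H] in
theorem exists_seq_finiteDimensional_tendsto (A : H →L[ℂ] H) (hA : IsCompactOperator A) :
    ∃ A' : ℕ → H →L[ℂ] H, (∀ n, ∃ V : Submodule ℂ H, FiniteDimensional ℂ V ∧
      ∀ x, A' n x ∈ V) ∧ Filter.Tendsto A' Filter.atTop (nhds A) := by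
  choose A' V h1 h2 h3 using fun n : ℕ =>
    exists_finiteDimensional_approx hA (Nat.one_div_pos_of_nat (α := ℝ) (n := n))
  refine ⟨A', fun n => ⟨V n, h1 n, h2 n⟩, ?_⟩
  rw [tendsto_iff_norm_sub_tendsto_zero]
  refine squeeze_zero (fun _ => norm_nonneg _) (fun n => ?_)
    (tendsto_one_div_add_atTop_nhds_zero_nat (𝕜 := ℝ))
  rw [norm_sub_rev]
  exact h3 n

theorem tendsto_bilin {E F G : Type*} [NormedAddCommGroup E] [NormedSpace ℂ E]
    [NormedAddCommGroup F] [NormedSpace ℂ F] [NormedAddCommGroup G] [NormedSpace ℂ G]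
    (φ : E →L[ℂ] F →L[ℂ] G) {u : ℕ → E} {v : ℕ → F} {x : E} {y : F}
    (hu : Filter.Tendsto u Filter.atTop (nhds x)) (hv : Filter.Tendsto v Filter.atTop (nhds y)) :
    Filter.Tendsto (fun n => φ (u n) (v n)) Filter.atTop (nhds (φ x y)) :=
  (φ.continuous₂.tendsto (x, y)).comp (hu.prodMk_nhds hv)

theorem isCompactOperator_opTens {A B : H →L[ℂ] H} (hA : IsCompactOperator A)
    (hB : IsCompactOperator B) : IsCompactOperator (opTens b A B) := by
  obtain ⟨A', hA1, hA2⟩ := exists_seq_finiteDimensional_tendsto A hA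
  obtain ⟨B', hB1, hB2⟩ := exists_seq_finiteDimensional_tendsto B hB
  have hlim : Filter.Tendsto (fun n => opTensL b (A' n) (B' n)) Filter.atTop
      (nhds (opTensL b A B)) :=
    tendsto_bilin (opTensL b) hA2 hB2
  refine isCompactOperator_of_tendsto (F := fun n => opTensL b (A' n) (B' n)) hlim
    (Filter.Eventually.of_forall fun n => ?_)
  obtain ⟨V, hV, hV'⟩ := hA1 n
  obtain ⟨W, hW, hW'⟩ := hB1 n
  exact opTens_finiteDimensional b hV' hW'

/-- The tensor product of compact operators. -/
def compactTens (A B : compactOperator (RingHom.id ℂ) H H) : compactOperator (RingHom.id ℂ) H H :=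
  ⟨opTens b A.1 B.1, isCompactOperator_opTens b A.2 B.2⟩

/-- The tensor product of compact operators as a bounded bilinear map. -/
def compactTensL : compactOperator (RingHom.id ℂ) H H →L[ℂ] compactOperator (RingHom.id ℂ) H H →L[ℂ]
    compactOperator (RingHom.id ℂ) H H :=
  LinearMap.mkContinuous₂ (LinearMap.mk₂ ℂ (compactTens b)
    (fun A A' B => Subtype.ext ((opTensL b).map_add₂ A.1 A'.1 B.1))
    (fun c A B => Subtype.ext ((opTensL b).map_smul₂ c A.1 B.1))
    (fun A B B' => Subtype.ext ((opTensL b A.1).map_add B.1 B'.1))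
    (fun c A B => Subtype.ext ((opTensL b A.1).map_smul c B.1))) 1
    (fun A B => by rw [one_mul]; exact norm_opTens_le b A.1 B.1)

theorem norm_compactTensL_le (A B : compactOperator (RingHom.id ℂ) H H) :
    ‖compactTensL b A B‖ ≤ ‖A‖ * ‖B‖ :=
  norm_opTens_le b A.1 B.1

end HilbertTensor

end S1Hardy
end

noncomputable section

namespace S1Hardy

/-! ### Trace class operators -/

section TraceClassTheory

variable {H : Type*} [NormedAddCommGroup H] [InnerProductSpace ℂ H] [CompleteSpace H]
  {ι : Type*} {b : HilbertBasis ι ℂ H}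

omit [CompleteSpace H] in
theorem sum_norm_inner_mul_le (b : HilbertBasis ι ℂ H) (s : Finset ι) (p q : H) :
    ∑ i ∈ s, ‖(inner ℂ p (b i) : ℂ) * inner ℂ (b i) q‖ ≤ ‖p‖ * ‖q‖ := by
  have h1 : ∑ i ∈ s, ‖(inner ℂ p (b i) : ℂ) * inner ℂ (b i) q‖ =
      ∑ i ∈ s, ‖(inner ℂ (b i) p : ℂ)‖ * ‖(inner ℂ (b i) q : ℂ)‖ :=
    Finset.sum_congr rfl fun i _ => by rw [norm_mul, norm_inner_symm]
  rw [h1]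
  refine (Real.sum_mul_le_sqrt_mul_sqrt _ _ _).trans ?_
  gcongr
  · exact Real.sqrt_le_left (norm_nonneg _) |>.2 (b.orthonormal.sum_inner_products_le p)
  · exact Real.sqrt_le_left (norm_nonneg _) |>.2 (b.orthonormal.sum_inner_products_le q)

theorem IsTraceClass.sum_norm_inner_le {T : H →L[ℂ] H} (hT : IsTraceClass b T) (s : Finset ι) :
    ∑ i ∈ s, ‖(inner ℂ (b i) (T (b i)) : ℂ)‖ ≤ traceNorm b T := by
  obtain ⟨x, y, h1, h2, h3⟩ := hT.exists_nuclear
  refine le_trans ?_ h2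
  have hle : ∀ i k, ‖(inner ℂ (x k) (b i) : ℂ) * inner ℂ (b i) (y k)‖ ≤ ‖x k‖ * ‖y k‖ :=
    fun i k => by simpa using sum_norm_inner_mul_le b {i} (x k) (y k)
  have hs : ∀ i, Summable fun k => ‖(inner ℂ (x k) (b i) : ℂ) * inner ℂ (b i) (y k)‖ := fun i =>
    Summable.of_nonneg_of_le (fun _ => norm_nonneg _) (hle i) h1
  have hin : ∀ i, HasSum (fun k => (inner ℂ (x k) (b i) : ℂ) * inner ℂ (b i) (y k))
      (inner ℂ (b i) (T (b i))) := by
    intro i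
    have h := (h3 (b i)).mapL (innerSL ℂ (b i))
    simpa [inner_smul_right] using h
  calc ∑ i ∈ s, ‖(inner ℂ (b i) (T (b i)) : ℂ)‖
      ≤ ∑ i ∈ s, ∑' k, ‖(inner ℂ (x k) (b i) : ℂ) * inner ℂ (b i) (y k)‖ := by
        refine Finset.sum_le_sum fun i _ => ?_
        rw [← (hin i).tsum_eq]
        exact norm_tsum_le_tsum_norm (hs i)
    _ = ∑' k, ∑ i ∈ s, ‖(inner ℂ (x k) (b i) : ℂ) * inner ℂ (b i) (y k)‖ :=
        (Summable.tsum_finsetSum fun i _ => hs i).symm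
    _ ≤ ∑' k, ‖x k‖ * ‖y k‖ :=
        (summable_sum fun i _ => hs i).tsum_le_tsum
          (fun k => sum_norm_inner_mul_le b s (x k) (y k)) h1

theorem IsTraceClass.summable_norm_inner {T : H →L[ℂ] H} (hT : IsTraceClass b T) :
    Summable fun i => ‖(inner ℂ (b i) (T (b i)) : ℂ)‖ :=
  summable_of_sum_le (fun _ => norm_nonneg _) hT.sum_norm_inner_le

theorem IsTraceClass.norm_trace_le {T : H →L[ℂ] H} (hT : IsTraceClass b T) :
    ‖trace b T‖ ≤ traceNorm b T :=
  (norm_tsum_le_tsum_norm hT.summable_norm_inner).trans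
    (hT.summable_norm_inner.tsum_le_of_sum_le hT.sum_norm_inner_le)

theorem IsTraceClass.clm_comp {T : H →L[ℂ] H} (hT : IsTraceClass b T) (A : H →L[ℂ] H) :
    IsTraceClass b (A ∘L T) ∧ traceNorm b (A ∘L T) ≤ ‖A‖ * traceNorm b T := by
  obtain ⟨x, y, h1, h2, h3⟩ := hT.exists_nuclear
  have hle : ∀ k, ‖x k‖ * ‖A (y k)‖ ≤ ‖A‖ * (‖x k‖ * ‖y k‖) := fun k => by
    have := mul_le_mul_of_nonneg_left (A.le_opNorm (y k)) (norm_nonneg (x k))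
    linarith
  have hs : Summable fun k => ‖x k‖ * ‖A (y k)‖ :=
    Summable.of_nonneg_of_le (fun _ => by positivity) hle (h1.mul_left _)
  obtain ⟨h4, h5⟩ := IsTraceClass.of_nuclear b (T := A ∘L T) hs (fun v => by
    simpa using (h3 v).mapL A)
  refine ⟨h4, h5.trans ((hs.tsum_le_tsum hle (h1.mul_left _)).trans ?_)⟩
  rw [tsum_mul_left]
  gcongr

theorem IsTraceClass.opNorm_le {T : H →L[ℂ] H} (hT : IsTraceClass b T) :
    ‖T‖ ≤ traceNorm b T := by
  obtain ⟨x, y, h1, h2, h3⟩ := hT.exists_nuclear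
  refine T.opNorm_le_bound (traceNorm_nonneg b T) fun v => ?_
  have hle : ∀ k, ‖(inner ℂ (x k) v : ℂ) • y k‖ ≤ ‖x k‖ * ‖y k‖ * ‖v‖ := fun k => by
    rw [norm_smul]
    have := mul_le_mul_of_nonneg_right (norm_inner_le_norm (𝕜 := ℂ) (x k) v) (norm_nonneg (y k))
    linarith
  rw [← (h3 v).tsum_eq]
  refine (tsum_of_norm_bounded (h1.mul_right ‖v‖).hasSum hle).trans ?_
  rw [tsum_mul_right]
  gcongr

/-- The trace norm is countably subadditive. -/
theorem IsTraceClass.of_hasSum {κ : Type*} {S : κ → H →L[ℂ] H} {T : H →L[ℂ] H}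
    (hS : ∀ k, IsTraceClass b (S k)) (hs : Summable fun k => traceNorm b (S k))
    (hT : HasSum S T) : IsTraceClass b T ∧ traceNorm b T ≤ ∑' k, traceNorm b (S k) := by
  choose x y h1 h2 h3 using fun k => (hS k).exists_nuclear
  have hsum : Summable fun p : κ × ι => ‖x p.1 p.2‖ * ‖y p.1 p.2‖ := by
    refine (summable_prod_of_nonneg fun _ => by positivity).2 ⟨h1, ?_⟩
    exact Summable.of_nonneg_of_le (fun k => tsum_nonneg fun _ => by positivity) h2 hs
  have hle : ∑' p : κ × ι, ‖x p.1 p.2‖ * ‖y p.1 p.2‖ ≤ ∑' k, traceNorm b (S k) := by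
    rw [hsum.tsum_prod' h1]
    exact (Summable.of_nonneg_of_le (fun k => tsum_nonneg fun _ => by positivity) h2
      hs).tsum_le_tsum
      h2 hs
  have hv : ∀ v, HasSum (fun p : κ × ι => (inner ℂ (x p.1 p.2) v : ℂ) • y p.1 p.2) (T v) := by
    intro v
    have hab : Summable fun p : κ × ι => (inner ℂ (x p.1 p.2) v : ℂ) • y p.1 p.2 := by
      refine Summable.of_norm_bounded (hsum.mul_right ‖v‖) fun p => ?_
      rw [norm_smul]
      have := mul_le_mul_of_nonneg_right (norm_inner_le_norm (𝕜 := ℂ) (x p.1 p.2) v)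
        (norm_nonneg (y p.1 p.2))
      linarith
    have h4 := hab.hasSum.prod_fiberwise fun k => h3 k v
    have h5 : HasSum (fun k => S k v) (T v) :=
      hT.mapL (ContinuousLinearMap.apply ℂ H v)
    rw [h5.unique h4]
    exact hab.hasSum
  obtain ⟨h6, h7⟩ := IsTraceClass.of_nuclear b hsum hv
  exact ⟨h6, h7.trans hle⟩

theorem TraceClass.isTraceClass (T : TraceClass b) : IsTraceClass b T.toCLM := T.2

theorem TraceClass.norm_def (T : TraceClass b) : ‖T‖ = traceNorm b T.toCLM := rfl

theorem TraceClass.toCLM_add (S T : TraceClass b) : (S + T).toCLM = S.toCLM + T.toCLM := rfl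

theorem TraceClass.toCLM_smul (c : ℂ) (T : TraceClass b) : (c • T).toCLM = c • T.toCLM := rfl

theorem TraceClass.opNorm_toCLM_le (T : TraceClass b) : ‖T.toCLM‖ ≤ ‖T‖ :=
  T.isTraceClass.opNorm_le

/-- The inclusion of the trace class operators into the bounded operators. -/
def TraceClass.toCLML : TraceClass b →ₗ[ℂ] (H →L[ℂ] H) where
  toFun := TraceClass.toCLM
  map_add' _ _ := rfl
  map_smul' _ _ := rfl

instance TraceClass.completeSpace : CompleteSpace (TraceClass b) := by
  refine NormedAddCommGroup.completeSpace_of_summable_imp_tendsto fun u hu => ?_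
  have hop : Summable fun n => (u n).toCLM :=
    Summable.of_norm (Summable.of_nonneg_of_le (fun _ => norm_nonneg _)
      (fun n => (u n).opNorm_toCLM_le) hu)
  have htail : ∀ N, IsTraceClass b (∑' n, (u (n + N)).toCLM) ∧
      traceNorm b (∑' n, (u (n + N)).toCLM) ≤ ∑' n, ‖u (n + N)‖ := fun N =>
    IsTraceClass.of_hasSum (fun n => (u (n + N)).isTraceClass) ((summable_nat_add_iff N).2 hu)
      ((summable_nat_add_iff N).2 hop).hasSum
  let a : TraceClass b := ⟨∑' n, (u n).toCLM, (htail 0).1⟩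
  refine ⟨a, ?_⟩
  rw [tendsto_iff_norm_sub_tendsto_zero]
  refine squeeze_zero (fun _ => norm_nonneg _) (fun N => ?_)
    (tendsto_sum_nat_add fun n => ‖u n‖)
  rw [norm_sub_rev]
  have h1 : (a - ∑ n ∈ Finset.range N, u n).toCLM = ∑' n, (u (n + N)).toCLM := by
    have h2 : (a - ∑ n ∈ Finset.range N, u n).toCLM =
        a.toCLM - ∑ n ∈ Finset.range N, (u n).toCLM := by
      change TraceClass.toCLML (a - ∑ n ∈ Finset.range N, u n) = _
      rw [map_sub, map_sum]
      rfl
    rw [h2, sub_eq_iff_eq_add']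
    exact (hop.sum_add_tsum_nat_add N).symm
  rw [TraceClass.norm_def, h1]
  exact (htail N).2

theorem IsTraceClass.trace_add {S T : H →L[ℂ] H} (hS : IsTraceClass b S)
    (hT : IsTraceClass b T) : trace b (S + T) = trace b S + trace b T := by
  rw [trace, trace, trace, ← hS.summable_norm_inner.of_norm.tsum_add
    hT.summable_norm_inner.of_norm]
  simp

omit [CompleteSpace H] in
theorem trace_smul (c : ℂ) (T : H →L[ℂ] H) : trace b (c • T) = c * trace b T := by
  rw [trace, trace, ← tsum_mul_left]
  simp

variable (b) in
/-- The trace pairing `(A, T) ↦ tr (A T)` of compact and trace class operators. -/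
def tracePairing : compactOperator (RingHom.id ℂ) H H →L[ℂ] TraceClass b →L[ℂ] ℂ :=
  LinearMap.mkContinuous₂ (LinearMap.mk₂ ℂ (fun A T => trace b (A.1 ∘L T.toCLM))
    (fun A A' T => by
      rw [← IsTraceClass.trace_add (T.isTraceClass.clm_comp A.1).1
        (T.isTraceClass.clm_comp A'.1).1]
      congr 1)
    (fun c A T => by rw [smul_eq_mul, ← trace_smul]; congr 1)
    (fun A S T => by
      rw [← IsTraceClass.trace_add (S.isTraceClass.clm_comp A.1).1
        (T.isTraceClass.clm_comp A.1).1, TraceClass.toCLM_add, ContinuousLinearMap.comp_add])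
    (fun c A T => by
      rw [smul_eq_mul, ← trace_smul, TraceClass.toCLM_smul, ContinuousLinearMap.comp_smul])) 1
    (fun A T => by
      rw [one_mul]
      exact (T.isTraceClass.clm_comp A.1).1.norm_trace_le.trans (T.isTraceClass.clm_comp A.1).2)

theorem norm_tracePairing_le (A : compactOperator (RingHom.id ℂ) H H) (T : TraceClass b) :
    ‖tracePairing b A T‖ ≤ ‖A‖ * ‖T‖ :=
  (T.isTraceClass.clm_comp A.1).1.norm_trace_le.trans (T.isTraceClass.clm_comp A.1).2

end TraceClassTheory

/-! ### Tensor products of trace class operators -/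

section TraceTensor

variable {H : Type*} [NormedAddCommGroup H] [InnerProductSpace ℂ H] [CompleteSpace H]
  (b : HilbertBasis ℕ ℂ H)

theorem IsTraceClass.opTens {S T : H →L[ℂ] H} (hS : IsTraceClass b S) (hT : IsTraceClass b T) :
    IsTraceClass b (opTens b S T) ∧
      traceNorm b (opTens b S T) ≤ traceNorm b S * traceNorm b T := by
  obtain ⟨x, y, h1, h2, h3⟩ := hS.exists_nuclear
  obtain ⟨x', y', h1', h2', h3'⟩ := hT.exists_nuclear
  let X : ℕ × ℕ → H := fun p => tens b (x p.1) (x' p.2)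
  let Y : ℕ × ℕ → H := fun p => tens b (y p.1) (y' p.2)
  have hXY : ∀ p, ‖X p‖ * ‖Y p‖ = (‖x p.1‖ * ‖y p.1‖) * (‖x' p.2‖ * ‖y' p.2‖) := fun p => by
    simp only [X, Y, norm_tens]; ring
  have hs : Summable fun p => ‖X p‖ * ‖Y p‖ := by
    simp only [hXY]
    exact h1.mul_of_nonneg h1' (fun _ => by positivity) (fun _ => by positivity)
  have hle : ∑' p, ‖X p‖ * ‖Y p‖ ≤ traceNorm b S * traceNorm b T := by
    have h4 : Summable fun p : ℕ × ℕ => (‖x p.1‖ * ‖y p.1‖) * (‖x' p.2‖ * ‖y' p.2‖) :=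
      h1.mul_of_nonneg h1' (fun _ => by positivity) (fun _ => by positivity)
    simp only [hXY]
    rw [← h1.tsum_mul_tsum h1' h4]
    exact mul_le_mul h2 h2' (tsum_nonneg fun _ => by positivity) (traceNorm_nonneg b S)
  -- The nuclear series converges in operator norm, so it suffices to test it on `u ⊗ v`.
  let R : ℕ × ℕ → H →L[ℂ] H := fun p => (innerSL ℂ (X p)).smulRight (Y p)
  have hR : Summable R := by
    refine Summable.of_norm_bounded hs fun p => ?_
    simp [R]
  have hRT : ∑' p, R p = S1Hardy.opTens b S T := by
    refine ext_tens b fun u v => ?_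
    have h5 : HasSum (fun p => R p (tens b u v)) ((∑' p, R p) (tens b u v)) :=
      hR.hasSum.mapL (ContinuousLinearMap.apply ℂ H (tens b u v))
    have h6 : ∀ p : ℕ × ℕ, R p (tens b u v) =
        tensL b ((inner ℂ (x p.1) u : ℂ) • y p.1) ((inner ℂ (x' p.2) v : ℂ) • y' p.2) := by
      intro p
      simp [R, X, Y, tensL_apply, inner_tens, smul_smul, mul_comm]
    simp only [h6] at h5
    rw [opTens_tens]
    have h7 := h5.prod_fiberwise fun k =>
      (h3' v).mapL (tensL b ((inner ℂ (x k) u : ℂ) • y k))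
    have h8 := (h3 u).mapL ((tensL b).flip (T v))
    exact h7.unique h8
  obtain ⟨h4, h5⟩ := IsTraceClass.of_nuclear b (T := S1Hardy.opTens b S T) hs (fun v => by
    have h5 := hR.hasSum.mapL (ContinuousLinearMap.apply ℂ H v)
    rw [hRT] at h5
    simpa [R] using h5)
  exact ⟨h4, h5.trans hle⟩

theorem trace_opTens {S T : H →L[ℂ] H} (hS : IsTraceClass b S) (hT : IsTraceClass b T) :
    trace b (opTens b S T) = trace b S * trace b T := by
  rw [trace, trace, trace, tsum_mul_tsum_of_summable_norm hS.summable_norm_inner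
    hT.summable_norm_inner, ← Nat.pairEquiv.symm.tsum_eq]
  refine tsum_congr fun n => ?_
  rw [basis_eq_tens b n, opTens_tens, inner_tens]
  rfl

/-- The tensor product of trace class operators as a bounded bilinear map. -/
def traceTensL : TraceClass b →L[ℂ] TraceClass b →L[ℂ] TraceClass b :=
  LinearMap.mkContinuous₂ (LinearMap.mk₂ ℂ
    (fun S T : TraceClass b => (⟨opTens b S.toCLM T.toCLM,
      (IsTraceClass.opTens b S.isTraceClass T.isTraceClass).1⟩ :
      TraceClass b))
    (fun S S' T => Subtype.ext ((opTensL b).map_add₂ S.1 S'.1 T.1))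
    (fun c S T => Subtype.ext ((opTensL b).map_smul₂ c S.1 T.1))
    (fun S T T' => Subtype.ext ((opTensL b S.1).map_add T.1 T'.1))
    (fun c S T => Subtype.ext ((opTensL b S.1).map_smul c T.1))) 1
    (fun S T => by rw [one_mul]; exact (IsTraceClass.opTens b S.isTraceClass T.isTraceClass).2)

theorem norm_traceTensL_le (S T : TraceClass b) : ‖traceTensL b S T‖ ≤ ‖S‖ * ‖T‖ :=
  (IsTraceClass.opTens b S.isTraceClass T.isTraceClass).2

theorem tracePairing_tens (A B : compactOperator (RingHom.id ℂ) H H) (S T : TraceClass b) :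
    tracePairing b (compactTensL b A B) (traceTensL b S T) =
      tracePairing b A S * tracePairing b B T := by
  have h : tracePairing b (compactTensL b A B) (traceTensL b S T) =
      trace b (opTens b A.1 B.1 ∘L opTens b S.toCLM T.toCLM) := rfl
  rw [h, opTens_comp, trace_opTens b (S.isTraceClass.clm_comp A.1).1
    (T.isTraceClass.clm_comp B.1).1]
  rfl

end TraceTensor

end S1Hardy
end

noncomputable section

namespace S1Hardy

open MeasureTheory
open scoped FourierTransform SchwartzMap ContDiff

/-! ### Products in the scalar Hardy space -/

section Shear

theorem measurePreserving_shear :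
    MeasurePreserving (fun p : ℝ × ℝ => (p.1, p.1 - p.2)) (volume.prod volume)
      (volume.prod volume) :=
  (MeasurePreserving.id volume).skew_product (g := fun x y : ℝ => x - y)
    (measurable_fst.sub measurable_snd)
    (Filter.Eventually.of_forall fun x => (Measure.measurePreserving_sub_left volume x).map_eq)

theorem measurableEmbedding_shear : MeasurableEmbedding fun p : ℝ × ℝ => (p.1, p.1 - p.2) :=
  (MeasurableEquiv.mk ⟨fun p : ℝ × ℝ => (p.1, p.1 - p.2), fun p => (p.1, p.1 - p.2),
      fun p => by simp, fun p => by simp⟩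
    (measurable_fst.prodMk (measurable_fst.sub measurable_snd))
    (measurable_fst.prodMk (measurable_fst.sub measurable_snd))).measurableEmbedding

theorem integrable_comp_shear {G : Type*} [NormedAddCommGroup G] {f : ℝ × ℝ → G}
    (hf : Integrable f (volume.prod volume)) :
    Integrable (fun p : ℝ × ℝ => f (p.1, p.1 - p.2)) (volume.prod volume) :=
  measurePreserving_shear.integrable_comp_of_integrable hf

theorem integral_comp_shear {G : Type*} [NormedAddCommGroup G] [NormedSpace ℝ G]
    (f : ℝ × ℝ → G) :
    ∫ p : ℝ × ℝ, f (p.1, p.1 - p.2) ∂(volume.prod volume) = ∫ p, f p ∂(volume.prod volume) :=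
  measurePreserving_shear.integral_comp measurableEmbedding_shear f

theorem prod_restrict_right (A : Set ℝ) :
    (volume : Measure ℝ).prod (volume.restrict A) =
      ((volume : Measure ℝ).prod volume).restrict (Set.univ ×ˢ A) := by
  rw [← Measure.prod_restrict, Measure.restrict_univ]

end Shear

/-- The character `t ↦ e^{-itu}`. -/
def expChar (u t : ℝ) : ℂ := Complex.exp (-(Complex.I * t * u))

theorem norm_expChar (u t : ℝ) : ‖expChar u t‖ = 1 := by
  rw [expChar, Complex.norm_exp]
  simp

theorem continuous_expChar (u : ℝ) : Continuous (expChar u) := by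
  unfold expChar
  fun_prop

theorem expChar_add_left (u v t : ℝ) : expChar (u + v) t = expChar u t * expChar v t := by
  rw [expChar, expChar, expChar, ← Complex.exp_add]
  congr 1
  push_cast
  ring

theorem expChar_sub_right (v t r : ℝ) : expChar v (t - r) = expChar v t * expChar (-v) r := by
  rw [expChar, expChar, expChar, ← Complex.exp_add]
  congr 1
  push_cast
  ring

theorem Integrable.mul_expChar {g : ℝ → ℂ} (hg : Integrable g) (u : ℝ) :
    Integrable fun t => g t * expChar u t :=
  hg.mul_bdd (c := 1) (continuous_expChar u).aestronglyMeasurable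
    (Filter.Eventually.of_forall fun t => (norm_expChar u t).le)

/-- An integrable function whose Fourier transform vanishes is zero almost everywhere. -/
theorem ae_eq_zero_of_integral_expChar {g : ℝ → ℂ} (hg : Integrable g)
    (h : ∀ v : ℝ, ∫ r, g r * expChar v r = 0) : g =ᵐ[volume] 0 := by
  have hF : 𝓕 g = 0 := by
    funext w
    rw [Real.fourier_eq', Pi.zero_apply, ← h (2 * Real.pi * w)]
    refine integral_congr_ae (Filter.Eventually.of_forall fun r => ?_)
    simp only [smul_eq_mul, expChar]
    rw [mul_comm]
    congr 2
    simp
    ring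
  refine ae_eq_zero_of_integral_contDiff_smul_eq_zero hg.locallyIntegrable fun φ hφ hc => ?_
  have hφ₁ : HasCompactSupport (Complex.ofRealCLM ∘ φ) := hc.comp_left rfl
  have hφ₂ : ContDiff ℝ ∞ (Complex.ofRealCLM ∘ φ) := by fun_prop
  let ψ : 𝓢(ℝ, ℂ) := 𝓕⁻ (hφ₁.toSchwartzMap hφ₂)
  have hψ : 𝓕 (ψ : ℝ → ℂ) = fun r => (φ r : ℂ) := by
    rw [← SchwartzMap.fourier_coe]
    simp only [ψ, FourierTransform.fourier_fourierInv_eq]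
    rfl
  have key := VectorFourier.integral_bilin_fourierIntegral_eq_flip
    (ContinuousLinearMap.mul ℂ ℂ) (L := innerₗ ℝ) (μ := volume) (ν := volume)
    Real.continuous_fourierChar continuous_inner ψ.integrable hg
  have e1 : VectorFourier.fourierIntegral Real.fourierChar volume (innerₗ ℝ) (ψ : ℝ → ℂ) =
      fun r => (φ r : ℂ) := hψ
  have e2 : VectorFourier.fourierIntegral Real.fourierChar volume (innerₗ ℝ).flip g = 0 := by
    rw [flip_innerₗ]
    exact hF
  rw [e1, e2] at key
  simpa using key

/-- For `g₁`, `g₂` in the Hardy space, the function `t ↦ g₁(t) ∫_{r ∈ A} g₂(t - r) dr` has the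
Fourier transform of a Hardy function. Indeed for almost every `r` the product
`t ↦ g₁(t) g₂(t - r)` does: the Fourier transform in `r` of its Fourier transform at `u ≤ 0` is
`v ↦ ĝ₁(u + v) ĝ₂(-v)`, and one of `u + v`, `-v` is nonpositive. -/
theorem integral_mul_average_expChar {g₁ g₂ : ℝ → ℂ} (h₁ : Integrable g₁) (h₂ : Integrable g₂)
    (z₁ : ∀ u : ℝ, u ≤ 0 → ∫ t, g₁ t * expChar u t = 0)
    (z₂ : ∀ u : ℝ, u ≤ 0 → ∫ t, g₂ t * expChar u t = 0) (A : Set ℝ) {u : ℝ} (hu : u ≤ 0) :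
    ∫ t, (g₁ t * ∫ r in A, g₂ (t - r)) * expChar u t = 0 := by
  let K : ℝ × ℝ → ℂ := fun p => (g₁ p.1 * expChar u p.1) * g₂ (p.1 - p.2)
  have hK : Integrable K (volume.prod volume) :=
    integrable_comp_shear ((Integrable.mul_expChar h₁ u).mul_prod h₂)
  have hG : (fun r => ∫ t, K (t, r)) =ᵐ[volume] 0 := by
    refine ae_eq_zero_of_integral_expChar hK.integral_prod_right fun v => ?_
    have hKv : Integrable (fun p : ℝ × ℝ => K p * expChar v p.2) (volume.prod volume) :=
      hK.mul_bdd (c := 1) ((continuous_expChar v).comp continuous_snd).aestronglyMeasurable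
        (Filter.Eventually.of_forall fun p => (norm_expChar v p.2).le)
    calc ∫ r, (∫ t, K (t, r)) * expChar v r
        = ∫ r, ∫ t, K (t, r) * expChar v r := by
          simp only [integral_mul_const]
      _ = ∫ p, K p * expChar v p.2 ∂(volume.prod volume) := (integral_prod_symm _ hKv).symm
      _ = ∫ p : ℝ × ℝ, (g₁ p.1 * expChar (u + v) p.1) * (g₂ p.2 * expChar (-v) p.2)
            ∂(volume.prod volume) := by
          rw [← integral_comp_shear fun p : ℝ × ℝ =>
            (g₁ p.1 * expChar (u + v) p.1) * (g₂ p.2 * expChar (-v) p.2)]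
          refine integral_congr_ae (Filter.Eventually.of_forall fun p => ?_)
          have : expChar v p.2 = expChar v p.1 * expChar (-v) (p.1 - p.2) := by
            rw [← expChar_sub_right]; simp
          simp only [K, this, expChar_add_left]
          ring
      _ = (∫ t, g₁ t * expChar (u + v) t) * ∫ r, g₂ r * expChar (-v) r :=
          integral_prod_mul (fun t => g₁ t * expChar (u + v) t) (fun r => g₂ r * expChar (-v) r)
      _ = 0 := by
          rcases le_total 0 v with hv | hv
          · rw [z₂ (-v) (by linarith), mul_zero]
          · rw [z₁ (u + v) (by linarith), zero_mul]
  calc ∫ t, (g₁ t * ∫ r in A, g₂ (t - r)) * expChar u t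
      = ∫ t, ∫ r in A, K (t, r) := by
        refine integral_congr_ae (Filter.Eventually.of_forall fun t => ?_)
        simp only [K, integral_const_mul]
        ring
    _ = ∫ r in A, ∫ t, K (t, r) := by
        refine integral_integral_swap (f := fun t r => K (t, r)) ?_
        rw [prod_restrict_right]
        exact hK.restrict
    _ = 0 := by
        rw [integral_congr_ae (ae_restrict_of_ae hG)]
        simp

end S1Hardy
end

noncomputable section

namespace S1Hardy

open MeasureTheory Filter Topology

/-! ### Uniformly continuous functions as sums of step functions -/

/-- A bounded uniformly continuous function on the line is the sum of a countable family of
functions `1_A D`, with pointwise sum of the norms exceeding its bound arbitrarily little. -/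
theorem exists_step_decomposition {X : Type*} [NormedAddCommGroup X] {Φ : ℝ → X}
    (hΦ : UniformContinuous Φ) {C : ℝ} (hC : ∀ r, ‖Φ r‖ ≤ C) {ε : ℝ} (hε : 0 < ε) :
    ∃ (D : ℕ × ℤ × ℤ → X) (A : ℕ × ℤ × ℤ → Set ℝ), (∀ q, MeasurableSet (A q)) ∧
      (∀ r, HasSum (fun q => (A q).indicator (fun _ => D q) r) (Φ r)) ∧
      ∀ r (s : Finset (ℕ × ℤ × ℤ)), ∑ q ∈ s, (A q).indicator (fun _ => ‖D q‖) r ≤ C + ε := by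
  let e : ℕ → ℝ := fun j => ε / 2 / 2 / 2 ^ j
  have he : ∀ j, 0 < e j := fun j => by positivity
  choose δ hδ hδΦ using fun j => Metric.uniformContinuous_iff.1 hΦ (e j) (he j)
  -- The grid of mesh `δ j` gives an approximation of `Φ` up to `e j`; the function `0` is put in
  -- front of these approximations.
  let P : ℕ → ℤ → X := fun j n => Nat.casesOn j 0 fun j => Φ (δ j * n)
  let κ : ℕ → ℝ → ℤ := fun j r => Nat.casesOn j 0 fun j => ⌊r / δ j⌋
  have hκ : ∀ j, Measurable (κ j) := by
    rintro (_ | j)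
    · exact measurable_const
    · exact Int.measurable_floor.comp (measurable_id.div_const _)
  let T : ℕ → ℝ → X := fun j r => P j (κ j r)
  have hT : ∀ j r, ‖T (j + 1) r - Φ r‖ ≤ e j := by
    intro j r
    have h : dist (δ j * ⌊r / δ j⌋) r < δ j := by
      have h1 := Int.floor_le (r / δ j)
      have h2 := Int.lt_floor_add_one (r / δ j)
      rw [le_div_iff₀ (hδ j)] at h1
      rw [div_lt_iff₀ (hδ j)] at h2
      rw [Real.dist_eq, abs_lt]
      constructor <;> nlinarith
    rw [← dist_eq_norm]
    exact (hδΦ j h).le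
  let c : ℕ → ℝ := fun j => Nat.casesOn j (C + e 0) fun j => e (j + 1) + e j
  have hTc : ∀ j r, ‖T (j + 1) r - T j r‖ ≤ c j := by
    rintro (_ | j) r
    · have h1 : T 0 r = 0 := rfl
      rw [h1, sub_zero]
      calc ‖T (0 + 1) r‖ = ‖(T (0 + 1) r - Φ r) + Φ r‖ := by rw [sub_add_cancel]
        _ ≤ e 0 + C := (norm_add_le _ _).trans (add_le_add (hT 0 r) (hC r))
        _ = c 0 := add_comm _ _
    · calc ‖T (j + 1 + 1) r - T (j + 1) r‖
          = ‖(T (j + 1 + 1) r - Φ r) - (T (j + 1) r - Φ r)‖ := by rw [sub_sub_sub_cancel_right]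
        _ ≤ e (j + 1) + e j := (norm_sub_le _ _).trans (add_le_add (hT _ r) (hT _ r))
  have hesum : HasSum e (ε / 2) := hasSum_geometric_two' (ε / 2)
  have hcsum : HasSum c (C + ε) := by
    have h1 : HasSum (fun j => e (j + 1)) (ε / 2 - e 0) := by
      simpa using (hasSum_nat_add_iff' 1).2 hesum
    have h2 : HasSum (fun j => c (j + 1)) ((ε / 2 - e 0) + ε / 2) := h1.add hesum
    have h3 := h2.zero_add
    have h4 : c 0 + ((ε / 2 - e 0) + ε / 2) = C + ε := by
      change (C + e 0) + ((ε / 2 - e 0) + ε / 2) = C + ε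
      ring
    rwa [h4] at h3
  have hnorm : ∀ r, Summable fun j => ‖T (j + 1) r - T j r‖ := fun r =>
    Summable.of_nonneg_of_le (fun _ => norm_nonneg _) (fun j => hTc j r) hcsum.summable
  have hsum : ∀ r, HasSum (fun j => T (j + 1) r - T j r) (Φ r) := by
    intro r
    refine (hasSum_iff_tendsto_nat_of_summable_norm (hnorm r)).2 ?_
    have h1 : Tendsto (fun j => T (j + 1) r) atTop (𝓝 (Φ r)) := by
      rw [tendsto_iff_norm_sub_tendsto_zero]
      exact squeeze_zero (fun _ => norm_nonneg _) (fun j => hT j r)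
        hesum.summable.tendsto_atTop_zero
    have h2 : Tendsto (fun j => T j r) atTop (𝓝 (Φ r)) := (tendsto_add_atTop_iff_nat 1).1 h1
    refine h2.congr fun n => ?_
    rw [Finset.sum_range_sub fun j => T j r]
    exact (sub_zero _).symm
  let D : ℕ × ℤ × ℤ → X := fun q => P (q.1 + 1) q.2.1 - P q.1 q.2.2
  let A : ℕ × ℤ × ℤ → Set ℝ := fun q => κ (q.1 + 1) ⁻¹' {q.2.1} ∩ κ q.1 ⁻¹' {q.2.2}
  let σ : ℝ → ℕ → ℕ × ℤ × ℤ := fun r j => (j, κ (j + 1) r, κ j r)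
  have hσ : ∀ r, Function.Injective (σ r) := fun r i j hij => congrArg Prod.fst hij
  have hA : ∀ r j, r ∈ A (σ r j) := fun r j => ⟨rfl, rfl⟩
  have hA' : ∀ r q, q ∉ Set.range (σ r) → r ∉ A q := by
    rintro r ⟨j, m, n⟩ hq ⟨h1, h2⟩
    rw [Set.mem_preimage, Set.mem_singleton_iff] at h1 h2
    exact hq ⟨j, by simp only [σ]; rw [h1, h2]⟩
  refine ⟨D, A, fun q => (hκ (q.1 + 1) (measurableSet_singleton q.2.1)).inter
    (hκ q.1 (measurableSet_singleton q.2.2)),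
    fun r => ?_, fun r s => ?_⟩
  · refine ((hσ r).hasSum_iff fun q hq => Set.indicator_of_notMem (hA' r q hq) _).1 ?_
    refine (hsum r).congr_fun fun j => ?_
    exact Set.indicator_of_mem (hA r j) fun _ => D (σ r j)
  · have h1 : HasSum (fun q => (A q).indicator (fun _ => ‖D q‖) r)
        (∑' j, ‖T (j + 1) r - T j r‖) := by
      refine ((hσ r).hasSum_iff fun q hq => Set.indicator_of_notMem (hA' r q hq) _).1 ?_
      refine (hnorm r).hasSum.congr_fun fun j => ?_
      exact Set.indicator_of_mem (hA r j) fun _ => ‖D (σ r j)‖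
    refine (sum_le_hasSum s
      (fun q _ => Set.indicator_nonneg (fun _ _ => norm_nonneg _) r) h1).trans ?_
    exact ((hnorm r).tsum_le_tsum (fun j => hTc j r) hcsum.summable).trans_eq hcsum.tsum_eq

end S1Hardy
end

noncomputable section

namespace S1Hardy

open MeasureTheory Filter Topology

/-! ### The averaged product of two Hardy functions -/

section Average

variable {Z : Type*} [NormedAddCommGroup Z] [NormedSpace ℂ Z]
  (m : Z →L[ℂ] Z →L[ℂ] Z)

/-- The averaged product `t ↦ ∫_{r ∈ A} a(t) ⊗ b(t - r) dr`, for a bilinear map `⊗`. -/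
def average (A : Set ℝ) (a b : ℝ → Z) (t : ℝ) : Z := ∫ r in A, m (a t) (b (t - r))

/-- The density `r ↦ ∫ ‖a(t)‖ ‖b(t - r)‖ dt`, which controls the norms of averaged products. -/
def shearWeight (a b : ℝ → Z) (r : ℝ) : ℝ := ∫ t, ‖a t‖ * ‖b (t - r)‖

variable {a b : ℝ → Z}

omit [NormedSpace ℂ Z] in
theorem shearWeight_nonneg (a b : ℝ → Z) (r : ℝ) : 0 ≤ shearWeight a b r :=
  integral_nonneg fun _ => by positivity

omit [NormedSpace ℂ Z] in
theorem integrable_norm_mul_norm_shear (ha : Integrable a) (hb : Integrable b) :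
    Integrable (fun p : ℝ × ℝ => ‖a p.1‖ * ‖b (p.1 - p.2)‖) (volume.prod volume) :=
  integrable_comp_shear (ha.norm.mul_prod hb.norm)

omit [NormedSpace ℂ Z] in
theorem integrable_shearWeight (ha : Integrable a) (hb : Integrable b) :
    Integrable (shearWeight a b) :=
  (integrable_norm_mul_norm_shear ha hb).integral_prod_right

omit [NormedSpace ℂ Z] in
theorem integral_shearWeight (ha : Integrable a) (hb : Integrable b) :
    ∫ r, shearWeight a b r = (∫ t, ‖a t‖) * ∫ t, ‖b t‖ := by
  have h1 := integral_prod_symm _ (integrable_norm_mul_norm_shear ha hb)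
  have h2 := integral_comp_shear fun p : ℝ × ℝ => ‖a p.1‖ * ‖b p.2‖
  have h3 := integral_prod_mul (μ := volume) (ν := volume) (fun t => ‖a t‖) (fun t => ‖b t‖)
  rw [← h3, ← h2, h1]
  rfl

theorem aestronglyMeasurable_bilin_shear (ha : Integrable a) (hb : Integrable b) :
    AEStronglyMeasurable (fun p : ℝ × ℝ => m (a p.1) (b (p.1 - p.2))) (volume.prod volume) := by
  have h1 : AEStronglyMeasurable (fun p : ℝ × ℝ => a p.1) (volume.prod volume) := ha.1.comp_fst
  have h2 : AEStronglyMeasurable (fun p : ℝ × ℝ => b (p.1 - p.2)) (volume.prod volume) :=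
    (hb.1.comp_snd (μ := (volume : Measure ℝ))).comp_measurePreserving measurePreserving_shear
  exact m.aestronglyMeasurable_comp₂ h1 h2

theorem integrable_bilin_shear (hm : ∀ x y, ‖m x y‖ ≤ ‖x‖ * ‖y‖) (ha : Integrable a)
    (hb : Integrable b) :
    Integrable (fun p : ℝ × ℝ => m (a p.1) (b (p.1 - p.2))) (volume.prod volume) :=
  (integrable_norm_mul_norm_shear ha hb).mono' (aestronglyMeasurable_bilin_shear m ha hb)
    (Eventually.of_forall fun _ => hm _ _)

theorem integrable_average (hm : ∀ x y, ‖m x y‖ ≤ ‖x‖ * ‖y‖) (ha : Integrable a)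
    (hb : Integrable b) (A : Set ℝ) : Integrable (average m A a b) := by
  have h : Integrable (fun p : ℝ × ℝ => m (a p.1) (b (p.1 - p.2)))
      (volume.prod (volume.restrict A)) := by
    rw [prod_restrict_right]
    exact (integrable_bilin_shear m hm ha hb).restrict
  exact h.integral_prod_left

theorem integral_norm_average_le (hm : ∀ x y, ‖m x y‖ ≤ ‖x‖ * ‖y‖) (ha : Integrable a)
    (hb : Integrable b) (A : Set ℝ) :
    ∫ t, ‖average m A a b t‖ ≤ ∫ r in A, shearWeight a b r := by
  have h : Integrable (fun p : ℝ × ℝ => ‖a p.1‖ * ‖b (p.1 - p.2)‖)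
      (volume.prod (volume.restrict A)) := by
    rw [prod_restrict_right]
    exact (integrable_norm_mul_norm_shear ha hb).restrict
  have h1 : ∫ r in A, shearWeight a b r = ∫ t, ∫ r in A, ‖a t‖ * ‖b (t - r)‖ :=
    (integral_integral_swap (f := fun t r => ‖a t‖ * ‖b (t - r)‖) h).symm
  rw [h1]
  refine integral_mono (integrable_average m hm ha hb A).norm h.integral_prod_left fun t => ?_
  refine norm_integral_le_of_norm_le ?_ (Eventually.of_forall fun r => hm _ _)
  exact ((hb.comp_sub_left t).norm.const_mul _).restrict

theorem average_eq [CompleteSpace Z] (hb : Integrable b) (A : Set ℝ) (t : ℝ) :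
    average m A a b t = m (a t) (∫ r in A, b (t - r)) :=
  (m (a t)).integral_comp_comm (hb.comp_sub_left t).restrict

theorem average_congr {a' b' : ℝ → Z} (ha : a =ᵐ[volume] a') (hb : b =ᵐ[volume] b')
    (A : Set ℝ) : average m A a b =ᵐ[volume] average m A a' b' := by
  filter_upwards [ha] with t ht
  refine integral_congr_ae (ae_restrict_of_ae ?_)
  have h := (Measure.measurePreserving_sub_left volume t).quasiMeasurePreserving.ae_eq_comp hb
  filter_upwards [h] with r hr
  simp only [Function.comp_apply] at hr
  rw [ht, hr]

variable (hm : ∀ x y, ‖m x y‖ ≤ ‖x‖ * ‖y‖)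

/-- The averaged product as an element of `L¹`. -/
def averageLp (A : Set ℝ) (h k : Lp Z 1 (volume : Measure ℝ)) : Lp Z 1 (volume : Measure ℝ) :=
  (integrable_average m hm (L1.integrable_coeFn h) (L1.integrable_coeFn k) A).toL1 _

theorem coeFn_averageLp (A : Set ℝ) (h k : Lp Z 1 (volume : Measure ℝ)) :
    averageLp m hm A h k =ᵐ[volume] average m A h k :=
  Integrable.coeFn_toL1 _

theorem norm_averageLp_le_setIntegral (A : Set ℝ) (h k : Lp Z 1 (volume : Measure ℝ)) :
    ‖averageLp m hm A h k‖ ≤ ∫ r in A, shearWeight h k r := by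
  have h1 : ∫ t, ‖averageLp m hm A h k t‖ = ∫ t, ‖average m A h k t‖ :=
    integral_congr_ae ((coeFn_averageLp m hm A h k).fun_comp norm)
  rw [L1.norm_eq_integral_norm, h1]
  exact integral_norm_average_le m hm (L1.integrable_coeFn h) (L1.integrable_coeFn k) A

theorem norm_averageLp_le (A : Set ℝ) (h k : Lp Z 1 (volume : Measure ℝ)) :
    ‖averageLp m hm A h k‖ ≤ ‖h‖ * ‖k‖ := by
  refine (norm_averageLp_le_setIntegral m hm A h k).trans ?_
  rw [L1.norm_eq_integral_norm, L1.norm_eq_integral_norm,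
    ← integral_shearWeight (L1.integrable_coeFn h) (L1.integrable_coeFn k)]
  exact setIntegral_le_integral
    (integrable_shearWeight (L1.integrable_coeFn h) (L1.integrable_coeFn k))
    (Eventually.of_forall fun r => shearWeight_nonneg _ _ r)

theorem integrable_bilin_section (h k : Lp Z 1 (volume : Measure ℝ)) (A : Set ℝ) (t : ℝ) :
    Integrable (fun r => m (h t) (k (t - r))) (volume.restrict A) :=
  ((m (h t)).integrable_comp ((L1.integrable_coeFn k).comp_sub_left t)).restrict

/-- The averaged product as a bounded bilinear map on `L¹`. -/
def averageL (A : Set ℝ) : Lp Z 1 (volume : Measure ℝ) →L[ℂ] Lp Z 1 (volume : Measure ℝ) →L[ℂ]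
    Lp Z 1 (volume : Measure ℝ) :=
  LinearMap.mkContinuous₂ (LinearMap.mk₂ ℂ (averageLp m hm A)
    (fun h h' k => by
      refine Lp.ext ((coeFn_averageLp m hm A _ _).trans ?_)
      filter_upwards [average_congr m (Lp.coeFn_add h h') (ae_eq_refl k) A,
        coeFn_averageLp m hm A h k, coeFn_averageLp m hm A h' k,
        Lp.coeFn_add (averageLp m hm A h k) (averageLp m hm A h' k)] with t h1 h2 h3 h4
      rw [h1, h4, Pi.add_apply, h2, h3]
      simp only [average, Pi.add_apply, map_add, add_apply]
      exact integral_add (integrable_bilin_section m h k A t) (integrable_bilin_section m h' k A t))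
    (fun c h k => by
      refine Lp.ext ((coeFn_averageLp m hm A _ _).trans ?_)
      filter_upwards [average_congr m (Lp.coeFn_smul c h) (ae_eq_refl k) A,
        coeFn_averageLp m hm A h k, Lp.coeFn_smul c (averageLp m hm A h k)] with t h1 h2 h4
      rw [h1, h4, Pi.smul_apply, h2]
      simp only [average, Pi.smul_apply, map_smul, smul_apply]
      exact integral_smul c _)
    (fun h k k' => by
      refine Lp.ext ((coeFn_averageLp m hm A _ _).trans ?_)
      filter_upwards [average_congr m (ae_eq_refl h) (Lp.coeFn_add k k') A,
        coeFn_averageLp m hm A h k, coeFn_averageLp m hm A h k',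
        Lp.coeFn_add (averageLp m hm A h k) (averageLp m hm A h k')] with t h1 h2 h3 h4
      rw [h1, h4, Pi.add_apply, h2, h3]
      simp only [average, Pi.add_apply, map_add]
      exact integral_add (integrable_bilin_section m h k A t) (integrable_bilin_section m h k' A t))
    (fun c h k => by
      refine Lp.ext ((coeFn_averageLp m hm A _ _).trans ?_)
      filter_upwards [average_congr m (ae_eq_refl h) (Lp.coeFn_smul c k) A,
        coeFn_averageLp m hm A h k, Lp.coeFn_smul c (averageLp m hm A h k)] with t h1 h2 h4
      rw [h1, h4, Pi.smul_apply, h2]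
      simp only [average, Pi.smul_apply, map_smul]
      exact integral_smul c _)) 1
    (fun h k => by rw [one_mul]; exact norm_averageLp_le m hm A h k)

theorem mem_hardyScalar_iff (g : Lp ℂ 1 (volume : Measure ℝ)) :
    g ∈ hardyScalar ↔ ∀ u : ℝ, u ≤ 0 → ∫ t, g t * expChar u t = 0 := Iff.rfl

/-- The averaged product of Hardy functions is a Hardy function. -/
theorem averageLp_mem_hardy [CompleteSpace Z] (A : Set ℝ) {h k : Lp Z 1 (volume : Measure ℝ)}
    (hh : h ∈ hardy Z) (hk : k ∈ hardy Z) : averageLp m hm A h k ∈ hardy Z := by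
  have hclosed : IsClosed (hardy Z : Set (Lp Z 1 (volume : Measure ℝ))) :=
    Submodule.isClosed_topologicalClosure _
  have hpure : ∀ g₁ ∈ hardyScalar, ∀ g₂ ∈ hardyScalar, ∀ (z₁ z₂ : Z)
      (h k : Lp Z 1 (volume : Measure ℝ)), (h =ᵐ[volume] fun t => g₁ t • z₁) →
      (k =ᵐ[volume] fun t => g₂ t • z₂) → averageLp m hm A h k ∈ hardy Z := by
    intro g₁ hg₁ g₂ hg₂ z₁ z₂ h k hh hk
    have hgi₁ := L1.integrable_coeFn g₁
    have hgi₂ := L1.integrable_coeFn g₂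
    have hint : Integrable (average (ContinuousLinearMap.mul ℂ ℂ) A g₁ g₂) :=
      integrable_average _ (fun x y => norm_mul_le x y) hgi₁ hgi₂ A
    refine Submodule.le_topologicalClosure _ (Submodule.subset_span
      ⟨hint.toL1 _, ?_, m z₁ z₂, ?_⟩)
    · rw [mem_hardyScalar_iff]
      intro u hu
      rw [← integral_mul_average_expChar hgi₁ hgi₂ hg₁ hg₂ A hu]
      refine integral_congr_ae ?_
      filter_upwards [hint.coeFn_toL1] with t ht
      rw [ht, average_eq _ hgi₂]
      rfl
    · refine (coeFn_averageLp m hm A h k).trans ((average_congr m hh hk A).trans ?_)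
      filter_upwards [hint.coeFn_toL1] with t ht
      rw [ht, average, average, ← integral_smul_const]
      refine integral_congr_ae (Eventually.of_forall fun r => ?_)
      simp only [map_smul, smul_apply, smul_smul, ContinuousLinearMap.mul_apply']
      rw [mul_comm]
  have step : ∀ g₁ ∈ hardyScalar, ∀ (z₁ : Z) (h : Lp Z 1 (volume : Measure ℝ)),
      (h =ᵐ[volume] fun t => g₁ t • z₁) → ∀ k ∈ hardy Z, averageLp m hm A h k ∈ hardy Z := by
    intro g₁ hg₁ z₁ h hh k hk
    have hle : hardy Z ≤ (hardy Z).comap (averageL m hm A h).toLinearMap := by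
      refine Submodule.topologicalClosure_minimal _ (Submodule.span_le.2 ?_)
        (hclosed.preimage (averageL m hm A h).continuous)
      rintro k ⟨g₂, hg₂, z₂, hk⟩
      exact hpure g₁ hg₁ g₂ hg₂ z₁ z₂ h k hh hk
    exact hle hk
  have hle : hardy Z ≤ (hardy Z).comap ((averageL m hm A).flip k).toLinearMap := by
    refine Submodule.topologicalClosure_minimal _ (Submodule.span_le.2 ?_)
      (hclosed.preimage ((averageL m hm A).flip k).continuous)
    rintro h ⟨g₁, hg₁, z₁, hh⟩
    exact step g₁ hg₁ z₁ h hh k hk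
  exact hle hh

end Average

end S1Hardy
end

noncomputable section

namespace S1Hardy

open MeasureTheory Filter Topology
open scoped ZeroAtInfty

/-! ### Functions vanishing at infinity -/

section ZeroAtInfty

variable {E : Type*} [NormedAddCommGroup E]

theorem norm_apply_le_norm (f : C₀(ℝ, E)) (x : ℝ) : ‖f x‖ ≤ ‖f‖ :=
  f.toBCF.norm_coe_le_norm x

theorem norm_le_of_forall_le {f : C₀(ℝ, E)} {C : ℝ} (hC : 0 ≤ C) (h : ∀ x, ‖f x‖ ≤ C) : ‖f‖ ≤ C :=
  (BoundedContinuousFunction.norm_le (f := f.toBCF) hC).2 h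

/-- The translate `x ↦ f (x + r)`. -/
def translate (f : C₀(ℝ, E)) (r : ℝ) : C₀(ℝ, E) where
  toFun x := f (x + r)
  continuous_toFun := (map_continuous f).comp (continuous_add_const r)
  zero_at_infty' := (zero_at_infty f).comp
    (Homeomorph.addRight r).isClosedEmbedding.tendsto_cocompact

theorem translate_apply (f : C₀(ℝ, E)) (r x : ℝ) : translate f r x = f (x + r) := rfl

theorem norm_translate_le (f : C₀(ℝ, E)) (r : ℝ) : ‖translate f r‖ ≤ ‖f‖ :=
  norm_le_of_forall_le (norm_nonneg _) fun x => norm_apply_le_norm f (x + r)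

theorem uniformContinuous_translate (f : C₀(ℝ, E)) : UniformContinuous (translate f) := by
  have hf : UniformContinuous (f : ℝ → E) := ZeroAtInftyContinuousMap.uniformContinuous f
  rw [Metric.uniformContinuous_iff] at hf ⊢
  intro ε hε
  obtain ⟨δ, hδ, h⟩ := hf (ε / 2) (half_pos hε)
  refine ⟨δ, hδ, fun r r' hr => ?_⟩
  rw [dist_eq_norm]
  refine lt_of_le_of_lt (norm_le_of_forall_le (half_pos hε).le fun x => ?_) (half_lt_self hε)
  have h1 : (translate f r - translate f r') x = f (x + r) - f (x + r') := rfl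
  rw [h1, ← dist_eq_norm]
  refine (h ?_).le
  simpa using hr

variable [NormedSpace ℂ E]

/-- Evaluation at a point, as a bounded linear map. -/
def evalL (x : ℝ) : C₀(ℝ, E) →L[ℂ] E :=
  LinearMap.mkContinuous
    { toFun := fun f => f x
      map_add' := fun _ _ => rfl
      map_smul' := fun _ _ => rfl } 1
    fun f => by rw [one_mul]; exact norm_apply_le_norm f x

theorem evalL_apply (x : ℝ) (f : C₀(ℝ, E)) : evalL x f = f x := rfl

variable (m : E →L[ℂ] E →L[ℂ] E) (hm : ∀ x y, ‖m x y‖ ≤ ‖x‖ * ‖y‖)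

/-- The pointwise product `x ↦ f(x) ⊗ g(x)`, for a contractive bilinear map `⊗`. -/
def zeroMul (f g : C₀(ℝ, E)) : C₀(ℝ, E) where
  toFun x := m (f x) (g x)
  continuous_toFun := m.continuous₂.comp ((map_continuous f).prodMk (map_continuous g))
  zero_at_infty' := by
    refine squeeze_zero_norm (fun x => (hm _ _).trans
      (mul_le_mul_of_nonneg_left (norm_apply_le_norm g x) (norm_nonneg _))) ?_
    simpa using (zero_at_infty f).norm.mul_const ‖g‖

theorem zeroMul_apply (f g : C₀(ℝ, E)) (x : ℝ) : zeroMul m hm f g x = m (f x) (g x) := rfl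

theorem norm_zeroMul_le (f g : C₀(ℝ, E)) : ‖zeroMul m hm f g‖ ≤ ‖f‖ * ‖g‖ :=
  norm_le_of_forall_le (by positivity) fun x => (hm _ _).trans
    (mul_le_mul (norm_apply_le_norm f x) (norm_apply_le_norm g x) (norm_nonneg _) (norm_nonneg _))

end ZeroAtInfty

/-! ### The product of two convolutions -/

section Product

variable {E Z : Type*} [NormedAddCommGroup E] [NormedSpace ℂ E] [NormedAddCommGroup Z]
  [NormedSpace ℂ Z] (τ : E →L[ℂ] Z →L[ℂ] ℂ)

/-- The convolution `s ↦ ∫ ⟨f(s - t), h(t)⟩ dt` for a bilinear pairing. -/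
def pairConv (f : C₀(ℝ, E)) (h : ℝ → Z) (s : ℝ) : ℂ := ∫ t, τ (f (s - t)) (h t)

variable {τ} (hτ : ∀ x z, ‖τ x z‖ ≤ ‖x‖ * ‖z‖)

include hτ in
theorem norm_pairing_le (f : C₀(ℝ, E)) (x : ℝ) (z : Z) : ‖τ (f x) z‖ ≤ ‖f‖ * ‖z‖ :=
  (hτ _ _).trans (mul_le_mul_of_nonneg_right (norm_apply_le_norm f x) (norm_nonneg _))

theorem aestronglyMeasurable_pairing (f : C₀(ℝ, E)) {h : ℝ → Z} (hh : AEStronglyMeasurable h)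
    (s : ℝ) : AEStronglyMeasurable fun t => τ (f (s - t)) (h t) :=
  τ.aestronglyMeasurable_comp₂
    ((map_continuous f).comp (continuous_sub_left s)).aestronglyMeasurable hh

include hτ in
theorem norm_pairConv_le (f : C₀(ℝ, E)) {h : ℝ → Z} (hh : Integrable h) (s : ℝ) :
    ‖pairConv τ f h s‖ ≤ ‖f‖ * ∫ t, ‖h t‖ := by
  rw [← integral_const_mul]
  exact norm_integral_le_of_norm_le (hh.norm.const_mul ‖f‖)
    (Eventually.of_forall fun _ => norm_pairing_le hτ f _ _)

variable (mE : E →L[ℂ] E →L[ℂ] E) (hmE : ∀ x y, ‖mE x y‖ ≤ ‖x‖ * ‖y‖)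
  (mZ : Z →L[ℂ] Z →L[ℂ] Z) (hmZ : ∀ x y, ‖mZ x y‖ ≤ ‖x‖ * ‖y‖)
  (hmul : ∀ x y z w, τ (mE x y) (mZ z w) = τ x z * τ y w)

variable {f₁ f₂ : C₀(ℝ, E)} {a b : ℝ → Z} {ι : Type*} {D : ι → C₀(ℝ, E)} {A : ι → Set ℝ}

omit [NormedSpace ℂ E] [NormedSpace ℂ Z] in
/-- For a bounded family of step functions, the weighted sum of the masses is bounded. -/
theorem summable_norm_mul_setIntegral (ha : Integrable a) (hb : Integrable b)
    (hA : ∀ q, MeasurableSet (A q)) {M : ℝ}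
    (hM : ∀ r (s : Finset ι), ∑ q ∈ s, (A q).indicator (fun _ => ‖D q‖) r ≤ M) :
    (Summable fun q => ‖D q‖ * ∫ r in A q, shearWeight a b r) ∧
      ∑' q, ‖D q‖ * ∫ r in A q, shearWeight a b r ≤ M * ((∫ t, ‖a t‖) * ∫ t, ‖b t‖) := by
  have hw := integrable_shearWeight ha hb
  have hnn : ∀ q, 0 ≤ ‖D q‖ * ∫ r in A q, shearWeight a b r := fun q =>
    mul_nonneg (norm_nonneg _) (integral_nonneg fun r => shearWeight_nonneg a b r)
  have hle : ∀ s : Finset ι, ∑ q ∈ s, ‖D q‖ * ∫ r in A q, shearWeight a b r ≤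
      M * ((∫ t, ‖a t‖) * ∫ t, ‖b t‖) := by
    intro s
    have h1 : ∀ q, ‖D q‖ * ∫ r in A q, shearWeight a b r =
        ∫ r, (A q).indicator (fun _ => ‖D q‖) r * shearWeight a b r := by
      intro q
      rw [← integral_const_mul, ← integral_indicator (hA q)]
      refine integral_congr_ae (Eventually.of_forall fun r => ?_)
      by_cases hr : r ∈ A q <;> simp [hr]
    have h2 : ∀ q, Integrable fun r => (A q).indicator (fun _ => ‖D q‖) r * shearWeight a b r := by
      intro q
      refine ((hw.const_mul ‖D q‖).indicator (hA q)).congr (Eventually.of_forall fun r => ?_)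
      by_cases hr : r ∈ A q <;> simp [hr]
    simp only [h1]
    rw [← integral_finsetSum s fun q _ => h2 q, ← integral_shearWeight ha hb,
      ← integral_const_mul]
    refine integral_mono (integrable_finsetSum s fun q _ => h2 q) (hw.const_mul M) fun r => ?_
    simp only
    rw [← Finset.sum_mul]
    exact mul_le_mul_of_nonneg_right (hM r s) (shearWeight_nonneg a b r)
  have hs := summable_of_sum_le hnn hle
  exact ⟨hs, hs.tsum_le_of_sum_le hle⟩

include hmul in
/-- The convolution of `f₁ ⊗ d` with an averaged product, as a double integral. -/
theorem pairConv_average [CompleteSpace Z] (hb : Integrable b) (d : C₀(ℝ, E)) {B : Set ℝ}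
    (s : ℝ) : pairConv τ (zeroMul mE hmE f₁ d) (average mZ B a b) s =
      ∫ t, ∫ r in B, τ (f₁ (s - t)) (a t) * τ (d (s - t)) (b (t - r)) := by
  refine integral_congr_ae (Eventually.of_forall fun t => ?_)
  simp only
  rw [average_eq mZ hb, zeroMul_apply, hmul, integral_const_mul]
  congr 1
  exact ((τ (d (s - t))).integral_comp_comm (hb.comp_sub_left t).restrict).symm

include hτ hmul in
/-- The product of the convolutions `f₁ ∗ a` and `f₂ ∗ b` is
`∫ (f₁ ⊗ f₂(· + r)) ∗ (a ⊗ b(· - r)) dr`; writing the translates `f₂(· + r)` as a sum of step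
functions of `r` turns this integral into a series of convolutions. -/
theorem hasSum_pairConv_average [CompleteSpace Z] [Countable ι] (ha : Integrable a)
    (hb : Integrable b) (hA : ∀ q, MeasurableSet (A q)) {M : ℝ}
    (hM : ∀ r (s : Finset ι), ∑ q ∈ s, (A q).indicator (fun _ => ‖D q‖) r ≤ M)
    (hD : ∀ r, HasSum (fun q => (A q).indicator (fun _ => D q) r) (translate f₂ r)) (s : ℝ) :
    HasSum (fun q => pairConv τ (zeroMul mE hmE f₁ (D q)) (average mZ (A q) a b) s)
      (pairConv τ f₁ a s * pairConv τ f₂ b s) := by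
  let V : ι → ℝ × ℝ → ℂ := fun q p => τ (f₁ (s - p.1)) (a p.1) * τ (D q (s - p.1)) (b (p.1 - p.2))
  let W : ι → Set (ℝ × ℝ) := fun q => Set.univ ×ˢ A q
  have hW : ∀ q, MeasurableSet (W q) := fun q => MeasurableSet.univ.prod (hA q)
  have hVle : ∀ q p, ‖V q p‖ ≤ ‖f₁‖ * ‖D q‖ * (‖a p.1‖ * ‖b (p.1 - p.2)‖) := by
    intro q p
    calc ‖V q p‖ = ‖τ (f₁ (s - p.1)) (a p.1)‖ * ‖τ (D q (s - p.1)) (b (p.1 - p.2))‖ :=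
          norm_mul _ _
      _ ≤ (‖f₁‖ * ‖a p.1‖) * (‖D q‖ * ‖b (p.1 - p.2)‖) :=
          mul_le_mul (norm_pairing_le hτ f₁ _ _) (norm_pairing_le hτ (D q) _ _)
            (norm_nonneg _) (by positivity)
      _ = _ := by ring
  have hdom := integrable_norm_mul_norm_shear ha hb
  have hVm : ∀ q, AEStronglyMeasurable (V q) (volume.prod volume) := by
    intro q
    have h1 : AEStronglyMeasurable (fun p : ℝ × ℝ => τ (f₁ (s - p.1)) (a p.1))
        (volume.prod volume) := (aestronglyMeasurable_pairing f₁ ha.1 s).comp_fst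
    have h2 : AEStronglyMeasurable (fun p : ℝ × ℝ => b (p.1 - p.2)) (volume.prod volume) :=
      (hb.1.comp_snd (μ := (volume : Measure ℝ))).comp_measurePreserving measurePreserving_shear
    have h3 : AEStronglyMeasurable (fun p : ℝ × ℝ => D q (s - p.1)) (volume.prod volume) :=
      ((map_continuous (D q)).comp (continuous_const.sub continuous_fst)).aestronglyMeasurable
    exact h1.mul (τ.aestronglyMeasurable_comp₂ h3 h2)
  have hVi : ∀ q, Integrable (V q) (volume.prod volume) := fun q =>
    (hdom.const_mul _).mono' (hVm q) (Eventually.of_forall (hVle q))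
  let U : ι → ℝ × ℝ → ℂ := fun q => (W q).indicator (V q)
  have hUi : ∀ q, Integrable (U q) (volume.prod volume) := fun q => (hVi q).indicator (hW q)
  have hdomq : ∀ q, Integrable (fun p : ℝ × ℝ => ‖a p.1‖ * ‖b (p.1 - p.2)‖)
      (volume.prod (volume.restrict (A q))) := fun q => by
    rw [prod_restrict_right]
    exact hdom.restrict
  have hUle : ∀ q, ∫ p, ‖U q p‖ ∂(volume.prod volume) ≤
      ‖f₁‖ * (‖D q‖ * ∫ r in A q, shearWeight a b r) := by
    intro q
    have h1 : ∫ p, ‖U q p‖ ∂(volume.prod volume) =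
        ∫ p, ‖V q p‖ ∂(volume.prod (volume.restrict (A q))) := by
      rw [prod_restrict_right, ← integral_indicator (hW q)]
      refine integral_congr_ae (Eventually.of_forall fun p => ?_)
      exact norm_indicator_eq_indicator_norm _ _
    have h2 : ∫ r in A q, shearWeight a b r =
        ∫ p, ‖a p.1‖ * ‖b (p.1 - p.2)‖ ∂(volume.prod (volume.restrict (A q))) :=
      (integral_prod_symm _ (hdomq q)).symm
    rw [h1, h2, ← mul_assoc, ← integral_const_mul]
    refine integral_mono_of_nonneg (Eventually.of_forall fun _ => norm_nonneg _)
      ((hdomq q).const_mul _) (Eventually.of_forall (hVle q))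
  have hsum : Summable fun q => ∫ p, ‖U q p‖ ∂(volume.prod volume) :=
    Summable.of_nonneg_of_le (fun q => integral_nonneg fun _ => norm_nonneg _) hUle
      ((summable_norm_mul_setIntegral ha hb hA hM).1.mul_left _)
  have hU : ∀ q, ∫ p, U q p ∂(volume.prod volume) =
      pairConv τ (zeroMul mE hmE f₁ (D q)) (average mZ (A q) a b) s := by
    intro q
    have h1 : Integrable (V q) (volume.prod (volume.restrict (A q))) := by
      rw [prod_restrict_right]
      exact (hVi q).restrict
    rw [pairConv_average mE hmE mZ hmul hb, integral_indicator (hW q), ← prod_restrict_right,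
      integral_prod _ h1]
  have hlim : ∀ p : ℝ × ℝ, ∑' q, U q p =
      τ (f₁ (s - p.1)) (a p.1) * τ (f₂ (s - (p.1 - p.2))) (b (p.1 - p.2)) := by
    intro p
    have h1 := (hD p.2).mapL ((τ.flip (b (p.1 - p.2))) ∘L evalL (s - p.1))
    have h2 := h1.mul_left (τ (f₁ (s - p.1)) (a p.1))
    have h3 : ((τ.flip (b (p.1 - p.2))) ∘L evalL (s - p.1)) (translate f₂ p.2) =
        τ (f₂ (s - (p.1 - p.2))) (b (p.1 - p.2)) := by
      rw [ContinuousLinearMap.comp_apply, evalL_apply, translate_apply,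
        show s - p.1 + p.2 = s - (p.1 - p.2) by ring]
      rfl
    rw [h3] at h2
    rw [← h2.tsum_eq]
    refine tsum_congr fun q => ?_
    by_cases hp : p.2 ∈ A q
    · have hp' : p ∈ W q := ⟨Set.mem_univ _, hp⟩
      simp only [U, Set.indicator_of_mem hp', Set.indicator_of_mem hp]
      rfl
    · have hp' : p ∉ W q := fun h => hp h.2
      simp only [U, Set.indicator_of_notMem hp', Set.indicator_of_notMem hp, map_zero, mul_zero]
  have key := hasSum_integral_of_summable_integral_norm hUi hsum
  simp only [hU, hlim] at key
  have h4 := integral_comp_shear fun p : ℝ × ℝ =>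
    τ (f₁ (s - p.1)) (a p.1) * τ (f₂ (s - p.2)) (b p.2)
  have h5 := integral_prod_mul (μ := volume) (ν := volume) (fun t => τ (f₁ (s - t)) (a t))
    (fun t => τ (f₂ (s - t)) (b t))
  rw [h4, h5] at key
  exact key

end Product

end S1Hardy
end

noncomputable section

namespace S1Hardy

open MeasureTheory Filter Topology
open scoped ZeroAtInfty

/-! ### Representations and their costs -/

section Generic

variable {E Z : Type*} [NormedAddCommGroup E] [NormedSpace ℂ E] [NormedAddCommGroup Z]
  [NormedSpace ℂ Z] (τ : E →L[ℂ] Z →L[ℂ] ℂ)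

/-- The convolution `f ∗ h` of `f` in `C₀(ℝ; E)` and `h` in `H¹(ℝ; Z)`, for a bilinear pairing of
`E` and `Z`. -/
def hardyConv (f : C₀(ℝ, E)) (h : hardy Z) (s : ℝ) : ℂ :=
  pairConv τ f (h : Lp Z 1 (volume : Measure ℝ)) s

/-- The sequences `f_k` and `h_k` satisfy `∑ ‖f_k‖ ‖h_k‖ < ∞` and represent `F`. -/
def IsRep (F : ℝ → ℂ) (f : ℕ → C₀(ℝ, E)) (h : ℕ → hardy Z) : Prop :=
  (Summable fun k => ‖f k‖ * ‖h k‖) ∧ ∀ s, HasSum (fun k => hardyConv τ (f k) (h k) s) (F s)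

/-- The space of represented functions; for the trace pairing this is `𝒜_{0,S^1}(ℝ)`. -/
def convSpace : Set (ℝ → ℂ) := {F | ∃ f h, IsRep τ F f h}

/-- The infimum of `∑ ‖f_k‖ ‖h_k‖` over all representations. -/
def convNorm (F : ℝ → ℂ) : ℝ := sInf {r | ∃ f h, IsRep τ F f h ∧ r = ∑' k, ‖f k‖ * ‖h k‖}

/-- `F` has a representation with `∑ ‖f_k‖ ‖h_k‖ ≤ c`. -/
def CostLE (F : ℝ → ℂ) (c : ℝ) : Prop :=
  ∃ f h, IsRep τ F f h ∧ ∑' k, ‖f k‖ * ‖h k‖ ≤ c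

variable {τ}

theorem hardyConv_smul (c : ℂ) (f : C₀(ℝ, E)) (h : hardy Z) (s : ℝ) :
    hardyConv τ (c • f) h s = c * hardyConv τ f h s := by
  rw [hardyConv, hardyConv, pairConv, pairConv, ← integral_const_mul]
  refine integral_congr_ae (Eventually.of_forall fun t => ?_)
  exact τ.map_smul₂ c (f (s - t)) _

theorem hardyConv_zero (h : hardy Z) (s : ℝ) : hardyConv τ 0 h s = 0 := by
  have := hardyConv_smul (τ := τ) 0 0 h s
  rwa [zero_smul, zero_mul] at this

variable (hτ : ∀ x z, ‖τ x z‖ ≤ ‖x‖ * ‖z‖)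

include hτ in
theorem norm_hardyConv_le (f : C₀(ℝ, E)) (h : hardy Z) (s : ℝ) :
    ‖hardyConv τ f h s‖ ≤ ‖f‖ * ‖h‖ := by
  have h1 := norm_pairConv_le hτ f (L1.integrable_coeFn (h : Lp Z 1 (volume : Measure ℝ))) s
  rwa [← L1.norm_eq_integral_norm] at h1

theorem CostLE.mem {F : ℝ → ℂ} {c : ℝ} (hF : CostLE τ F c) : F ∈ convSpace τ :=
  let ⟨f, h, hr, _⟩ := hF
  ⟨f, h, hr⟩

theorem CostLE.mono {F : ℝ → ℂ} {c d : ℝ} (hF : CostLE τ F c) (hcd : c ≤ d) : CostLE τ F d :=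
  let ⟨f, h, hr, hc⟩ := hF
  ⟨f, h, hr, hc.trans hcd⟩

/-- Representations may be indexed by any countable type. -/
theorem CostLE.of_countable {ι : Type*} [Countable ι] {F : ℝ → ℂ} {f : ι → C₀(ℝ, E)}
    {h : ι → hardy Z} {c : ℝ} (hs : Summable fun i => ‖f i‖ * ‖h i‖)
    (hc : ∑' i, ‖f i‖ * ‖h i‖ ≤ c) (hF : ∀ s, HasSum (fun i => hardyConv τ (f i) (h i) s) (F s)) :
    CostLE τ F c := by
  obtain ⟨g, hg⟩ := Countable.exists_injective_nat ι
  let f' : ℕ → C₀(ℝ, E) := Function.extend g f (0 : ℕ → C₀(ℝ, E))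
  let h' : ℕ → hardy Z := Function.extend g h (0 : ℕ → hardy Z)
  have hf' : ∀ i, f' (g i) = f i := fun i => hg.extend_apply f _ i
  have hh' : ∀ i, h' (g i) = h i := fun i => hg.extend_apply h _ i
  have hf0 : ∀ n, n ∉ Set.range g → f' n = 0 := fun n hn => Function.extend_apply' f _ n hn
  have h1 : HasSum (fun n => ‖f' n‖ * ‖h' n‖) (∑' i, ‖f i‖ * ‖h i‖) := by
    refine (hg.hasSum_iff fun n hn => ?_).1 ?_
    · rw [hf0 n hn, norm_zero, zero_mul]
    · refine hs.hasSum.congr_fun fun i => ?_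
      simp only [Function.comp_apply, hf', hh']
  refine ⟨f', h', ⟨h1.summable, fun s => ?_⟩, h1.tsum_eq.trans_le hc⟩
  refine (hg.hasSum_iff fun n hn => ?_).1 ?_
  · rw [hf0 n hn, hardyConv_zero]
  · refine (hF s).congr_fun fun i => ?_
    simp only [Function.comp_apply, hf', hh']

include hτ in
/-- Costs are countably subadditive. -/
theorem CostLE.hasSum {ι : Type*} [Countable ι] {F : ι → ℝ → ℂ} {c : ι → ℝ} {G : ℝ → ℂ}
    (hF : ∀ i, CostLE τ (F i) (c i)) (hc : Summable c) (hG : ∀ s, HasSum (fun i => F i s) (G s)) :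
    CostLE τ G (∑' i, c i) := by
  choose f h hr hle using hF
  have hnn : ∀ i, 0 ≤ ∑' k, ‖f i k‖ * ‖h i k‖ := fun i => tsum_nonneg fun k => by positivity
  have hs1 : Summable fun i => ∑' k, ‖f i k‖ * ‖h i k‖ := Summable.of_nonneg_of_le hnn hle hc
  have hs : Summable fun p : ι × ℕ => ‖f p.1 p.2‖ * ‖h p.1 p.2‖ :=
    (summable_prod_of_nonneg fun _ => by positivity).2 ⟨fun i => (hr i).1, hs1⟩
  refine CostLE.of_countable hs ?_ fun s => ?_
  · rw [hs.tsum_prod' fun i => (hr i).1]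
    exact hs1.tsum_le_tsum hle hc
  · have h1 : Summable fun p : ι × ℕ => hardyConv τ (f p.1 p.2) (h p.1 p.2) s :=
      Summable.of_norm_bounded hs fun p => norm_hardyConv_le hτ _ _ _
    rw [(hG s).unique (h1.hasSum.prod_fiberwise fun i => (hr i).2 s)]
    exact h1.hasSum

theorem CostLE.zero : CostLE τ 0 0 :=
  CostLE.of_countable (ι := Empty) (f := fun i => i.elim) (h := fun i => i.elim) summable_empty
    (by simp) (fun _ => hasSum_empty)

include hτ in
theorem CostLE.add {F G : ℝ → ℂ} {c d : ℝ} (hF : CostLE τ F c) (hG : CostLE τ G d) :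
    CostLE τ (F + G) (c + d) := by
  have h1 := CostLE.hasSum hτ (ι := Bool) (F := fun i => bif i then F else G)
    (c := fun i => bif i then c else d) (G := F + G) (by rintro (_ | _) <;> assumption)
    (Summable.of_finite) (fun s => by
      have := hasSum_fintype fun i : Bool => (bif i then F else G) s
      simpa using this)
  simpa using h1

theorem CostLE.smul {F : ℝ → ℂ} {c : ℝ} (hF : CostLE τ F c) (a : ℂ) :
    CostLE τ (a • F) (‖a‖ * c) := by
  obtain ⟨f, h, hr, hc⟩ := hF
  have h1 : ∀ k, ‖a • f k‖ * ‖h k‖ = ‖a‖ * (‖f k‖ * ‖h k‖) := fun k => by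
    rw [norm_smul, mul_assoc]
  refine ⟨fun k => a • f k, h, ⟨?_, fun s => ?_⟩, ?_⟩
  · simp only [h1]
    exact hr.1.mul_left _
  · simp only [hardyConv_smul]
    exact (hr.2 s).mul_left a
  · simp only [h1, tsum_mul_left]
    gcongr

include hτ in
theorem CostLE.norm_le {F : ℝ → ℂ} {c : ℝ} (hF : CostLE τ F c) (s : ℝ) : ‖F s‖ ≤ c := by
  obtain ⟨f, h, hr, hc⟩ := hF
  rw [← (hr.2 s).tsum_eq]
  exact (tsum_of_norm_bounded hr.1.hasSum fun k => norm_hardyConv_le hτ _ _ s).trans hc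

variable (mE : E →L[ℂ] E →L[ℂ] E) (hmE : ∀ x y, ‖mE x y‖ ≤ ‖x‖ * ‖y‖)
  (mZ : Z →L[ℂ] Z →L[ℂ] Z) (hmZ : ∀ x y, ‖mZ x y‖ ≤ ‖x‖ * ‖y‖)
  (hmul : ∀ x y z w, τ (mE x y) (mZ z w) = τ x z * τ y w)

include hτ hmE hmZ hmul in
/-- The product of two convolutions is represented at a cost arbitrarily close to the product of
the norms. -/
theorem CostLE.hardyConv_mul [CompleteSpace Z] (f₁ f₂ : C₀(ℝ, E)) (h₁ h₂ : hardy Z) {ε : ℝ}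
    (hε : 0 < ε) :
    CostLE τ (hardyConv τ f₁ h₁ * hardyConv τ f₂ h₂) ((‖f₁‖ * ‖h₁‖) * (‖f₂‖ * ‖h₂‖) + ε) := by
  set N := ‖f₁‖ * ‖h₁‖ * ‖h₂‖ with hN
  have hN0 : 0 ≤ N := by positivity
  -- The step decomposition costs an additional `ε' * N`, which has to stay below `ε`.
  let ε' := ε / (N + 1)
  have hε' : 0 < ε' := by positivity
  obtain ⟨D, A, hA, hD, hM⟩ := exists_step_decomposition (uniformContinuous_translate f₂)
    (norm_translate_le f₂) hε'
  have hi₁ := L1.integrable_coeFn (h₁ : Lp Z 1 (volume : Measure ℝ))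
  have hi₂ := L1.integrable_coeFn (h₂ : Lp Z 1 (volume : Measure ℝ))
  obtain ⟨hs, hle⟩ := summable_norm_mul_setIntegral hi₁ hi₂ hA hM
  let k : ℕ × ℤ × ℤ → hardy Z := fun q =>
    ⟨averageLp mZ hmZ (A q) h₁ h₂,
      averageLp_mem_hardy _ _ (A q) h₁.2 h₂.2⟩
  let f : ℕ × ℤ × ℤ → C₀(ℝ, E) := fun q =>
    zeroMul mE hmE f₁ (D q)
  have hfk : ∀ q, ‖f q‖ * ‖k q‖ ≤ ‖f₁‖ * (‖D q‖ * ∫ r in A q,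
      shearWeight (h₁ : Lp Z 1 (volume : Measure ℝ)) (h₂ : Lp Z 1 (volume : Measure ℝ)) r) := by
    intro q
    rw [← mul_assoc]
    exact mul_le_mul (norm_zeroMul_le _ _ f₁ (D q))
      (norm_averageLp_le_setIntegral mZ hmZ (A q) _ _) (norm_nonneg _) (by positivity)
  have hs' : Summable fun q => ‖f q‖ * ‖k q‖ :=
    Summable.of_nonneg_of_le (fun _ => by positivity) hfk (hs.mul_left _)
  refine CostLE.of_countable hs' ?_ fun s => ?_
  · refine (hs'.tsum_le_tsum hfk (hs.mul_left _)).trans ?_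
    rw [tsum_mul_left]
    refine (mul_le_mul_of_nonneg_left hle (norm_nonneg f₁)).trans ?_
    rw [← L1.norm_eq_integral_norm, ← L1.norm_eq_integral_norm]
    have h1 : ε' * N ≤ ε := by
      rw [div_mul_eq_mul_div, div_le_iff₀ (by positivity)]
      nlinarith
    change ‖f₁‖ * ((‖f₂‖ + ε') * (‖h₁‖ * ‖h₂‖)) ≤ _
    nlinarith
  · have h1 := hasSum_pairConv_average hτ mE hmE mZ hmul (f₁ := f₁) hi₁ hi₂ hA hM hD s
    refine h1.congr_fun fun q => ?_
    refine integral_congr_ae ?_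
    filter_upwards [coeFn_averageLp mZ hmZ (A q) (h₁ : Lp Z 1 (volume : Measure ℝ)) h₂] with t ht
    simp only [k, ht]
    rfl

theorem exists_pos_hasSum_le {ε : ℝ} (hε : 0 < ε) :
    ∃ e : ℕ × ℕ → ℝ, (∀ p, 0 < e p) ∧ ∃ b, HasSum e b ∧ b ≤ ε :=
  ⟨_, (posSumOfEncodable hε (ℕ × ℕ)).2⟩

include hτ in
/-- The product of two absolutely convergent series costs at most the sum of the costs of the
products of their terms. -/
theorem CostLE.mul_of_hasSum {u v : ℕ → ℝ → ℂ} {F G : ℝ → ℂ} {a b : ℕ → ℝ} (ha : Summable a)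
    (hb : Summable b) (hu : ∀ n s, ‖u n s‖ ≤ a n) (hv : ∀ n s, ‖v n s‖ ≤ b n)
    (hF : ∀ s, HasSum (fun n => u n s) (F s)) (hG : ∀ s, HasSum (fun n => v n s) (G s))
    (huv : ∀ n k, ∀ ε > 0, CostLE τ (u n * v k) (a n * b k + ε)) {ε : ℝ} (hε : 0 < ε) :
    CostLE τ (F * G) ((∑' n, a n) * (∑' k, b k) + ε) := by
  obtain ⟨e, he, d, hd, hdε⟩ := exists_pos_hasSum_le hε
  have ha0 : 0 ≤ a := fun n => (norm_nonneg _).trans (hu n 0)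
  have hb0 : 0 ≤ b := fun n => (norm_nonneg _).trans (hv n 0)
  have hs : Summable fun p : ℕ × ℕ => a p.1 * b p.2 := ha.mul_of_nonneg hb ha0 hb0
  have hFG : ∀ s, HasSum (fun p : ℕ × ℕ => (u p.1 * v p.2) s) ((F * G) s) := fun s =>
    HasSum.mul (f := fun n => u n s) (g := fun n => v n s) (hF s) (hG s)
      (summable_mul_of_summable_norm (f := fun n => u n s) (g := fun n => v n s)
        (Summable.of_nonneg_of_le (fun _ => norm_nonneg _) (fun n => hu n s) ha)
        (Summable.of_nonneg_of_le (fun _ => norm_nonneg _) (fun n => hv n s) hb))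
  refine (CostLE.hasSum hτ (fun p : ℕ × ℕ => huv p.1 p.2 (e p) (he p)) (hs.add hd.summable)
    hFG).mono ?_
  rw [hs.tsum_add hd.summable, hd.tsum_eq, ← ha.tsum_mul_tsum hb hs]
  exact add_le_add_right hdε _

include hτ hmE hmZ hmul in
theorem CostLE.mul [CompleteSpace Z] {F G : ℝ → ℂ} {c d : ℝ} (hF : CostLE τ F c)
    (hG : CostLE τ G d) {ε : ℝ} (hε : 0 < ε) : CostLE τ (F * G) (c * d + ε) := by
  obtain ⟨f, h, hr, hc⟩ := hF
  obtain ⟨g, k, hr', hd⟩ := hG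
  have hc0 : 0 ≤ ∑' k, ‖f k‖ * ‖h k‖ := tsum_nonneg fun _ => by positivity
  have hd0 : 0 ≤ ∑' l, ‖g l‖ * ‖k l‖ := tsum_nonneg fun _ => by positivity
  refine (CostLE.mul_of_hasSum hτ (u := fun n => hardyConv τ (f n) (h n))
    (v := fun n => hardyConv τ (g n) (k n)) hr.1 hr'.1 (fun n s => norm_hardyConv_le hτ _ _ s)
    (fun n s => norm_hardyConv_le hτ _ _ s) hr.2 hr'.2 (fun n l ε hε =>
      CostLE.hardyConv_mul hτ mE hmE mZ hmZ hmul (f n) (g l) (h n) (k l) hε) hε).mono ?_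
  exact add_le_add_left (mul_le_mul hc hd hd0 (hc0.trans hc)) _

/-! ### The norm -/

theorem CostLE.convNorm_le {F : ℝ → ℂ} {c : ℝ} (hF : CostLE τ F c) : convNorm τ F ≤ c := by
  obtain ⟨f, h, hr, hc⟩ := hF
  refine le_trans (csInf_le ⟨0, ?_⟩ ⟨f, h, hr, rfl⟩) hc
  rintro _ ⟨f, h, -, rfl⟩
  exact tsum_nonneg fun _ => by positivity

theorem costLE_of_convNorm_lt {F : ℝ → ℂ} (hF : F ∈ convSpace τ) {c : ℝ}
    (hc : convNorm τ F < c) : CostLE τ F c := by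
  obtain ⟨f, h, hr⟩ := hF
  have hne : {r | ∃ f h, IsRep τ F f h ∧ r = ∑' k, ‖f k‖ * ‖h k‖}.Nonempty := ⟨_, f, h, hr, rfl⟩
  obtain ⟨_, ⟨f', h', hr', rfl⟩, hlt⟩ := exists_lt_of_csInf_lt hne hc
  exact ⟨f', h', hr', hlt.le⟩

theorem costLE_convNorm_add {F : ℝ → ℂ} (hF : F ∈ convSpace τ) {ε : ℝ} (hε : 0 < ε) :
    CostLE τ F (convNorm τ F + ε) :=
  costLE_of_convNorm_lt hF (lt_add_of_pos_right _ hε)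

variable (τ) in
theorem convNorm_nonneg (F : ℝ → ℂ) : 0 ≤ convNorm τ F := by
  refine Real.sInf_nonneg ?_
  rintro _ ⟨f, h, -, rfl⟩
  exact tsum_nonneg fun _ => by positivity

include hτ in
theorem norm_apply_le_convNorm {F : ℝ → ℂ} (hF : F ∈ convSpace τ) (s : ℝ) :
    ‖F s‖ ≤ convNorm τ F :=
  le_of_forall_pos_le_add fun _ hε => (costLE_convNorm_add hF hε).norm_le hτ s

theorem convNorm_zero : convNorm τ (0 : ℝ → ℂ) = 0 :=
  le_antisymm CostLE.zero.convNorm_le (convNorm_nonneg τ 0)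

include hτ in
theorem convNorm_add_le {F G : ℝ → ℂ} (hF : F ∈ convSpace τ) (hG : G ∈ convSpace τ) :
    convNorm τ (F + G) ≤ convNorm τ F + convNorm τ G := by
  refine le_of_forall_pos_le_add fun ε hε => ?_
  have h :=
    ((costLE_convNorm_add hF (half_pos hε)).add hτ
      (costLE_convNorm_add hG (half_pos hε))).convNorm_le
  linarith

theorem convNorm_smul_le {F : ℝ → ℂ} (hF : F ∈ convSpace τ) (a : ℂ) :
    convNorm τ (a • F) ≤ ‖a‖ * convNorm τ F := by
  have h : ∀ ε > 0, convNorm τ (a • F) ≤ ‖a‖ * (convNorm τ F + ε) := fun ε hε =>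
    ((costLE_convNorm_add hF hε).smul a).convNorm_le
  have hlim : Tendsto (fun ε : ℝ => ‖a‖ * (convNorm τ F + ε)) (𝓝[>] 0)
      (𝓝 (‖a‖ * (convNorm τ F + 0))) :=
    ((continuous_const.mul (continuous_const.add continuous_id)).tendsto 0).mono_left
      nhdsWithin_le_nhds
  rw [add_zero] at hlim
  exact ge_of_tendsto hlim (eventually_nhdsWithin_of_forall h)

theorem smul_mem_convSpace {F : ℝ → ℂ} (hF : F ∈ convSpace τ) (a : ℂ) : a • F ∈ convSpace τ :=
  ((costLE_convNorm_add hF one_pos).smul a).mem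

theorem convNorm_smul {F : ℝ → ℂ} (hF : F ∈ convSpace τ) (a : ℂ) :
    convNorm τ (a • F) = ‖a‖ * convNorm τ F := by
  refine le_antisymm (convNorm_smul_le hF a) ?_
  rcases eq_or_ne a 0 with rfl | ha
  · rw [norm_zero, zero_mul]
    exact convNorm_nonneg τ _
  · have h := convNorm_smul_le (smul_mem_convSpace hF a) a⁻¹
    rw [inv_smul_smul₀ ha, norm_inv] at h
    rwa [← le_inv_mul_iff₀ (norm_pos_iff.2 ha)]

include hτ hmE hmZ hmul in
theorem convNorm_mul_le [CompleteSpace Z] {F G : ℝ → ℂ} (hF : F ∈ convSpace τ)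
    (hG : G ∈ convSpace τ) :
    convNorm τ (F * G) ≤ convNorm τ F * convNorm τ G := by
  have h : ∀ ε > 0, convNorm τ (F * G) ≤ (convNorm τ F + ε) * (convNorm τ G + ε) + ε :=
    fun ε hε =>
    ((costLE_convNorm_add hF hε).mul hτ mE hmE mZ hmZ hmul
      (costLE_convNorm_add hG hε) hε).convNorm_le
  have hlim : Tendsto (fun ε : ℝ => (convNorm τ F + ε) * (convNorm τ G + ε) + ε) (𝓝[>] 0)
      (𝓝 ((convNorm τ F + 0) * (convNorm τ G + 0) + 0)) :=
    (Continuous.tendsto (by fun_prop) 0).mono_left nhdsWithin_le_nhds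
  rw [add_zero, add_zero, add_zero] at hlim
  exact ge_of_tendsto hlim (eventually_nhdsWithin_of_forall h)

/-- The represented functions as an algebra; for the trace pairing this is `𝒜_{0,S^1}(ℝ)`. -/
def convAlgebra [CompleteSpace Z] : NonUnitalSubalgebra ℂ (ℝ → ℂ) where
  carrier := convSpace τ
  add_mem' hF hG := ((costLE_convNorm_add hF one_pos).add hτ (costLE_convNorm_add hG one_pos)).mem
  zero_mem' := CostLE.zero.mem
  mul_mem' hF hG :=
    ((costLE_convNorm_add hF one_pos).mul hτ mE hmE mZ hmZ hmul
      (costLE_convNorm_add hG one_pos) one_pos).mem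
  smul_mem' a _ hF := smul_mem_convSpace hF a

/-- The infimum of the costs as an algebra norm. -/
def convRingNorm [CompleteSpace Z] : RingNorm (convAlgebra hτ mE hmE mZ hmZ hmul) where
  toFun F := convNorm τ F
  map_zero' := convNorm_zero
  add_le' F G := convNorm_add_le hτ F.2 G.2
  neg' F := by
    have h := convNorm_smul F.2 (-1)
    rw [norm_neg, norm_one, one_mul, neg_one_smul] at h
    exact h
  mul_le' F G := convNorm_mul_le hτ mE hmE mZ hmZ hmul F.2 G.2
  eq_zero_of_map_eq_zero' F hF := by
    refine Subtype.ext (funext fun s => norm_le_zero_iff.1 ?_)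
    exact (norm_apply_le_convNorm hτ F.2 s).trans_eq hF

/-- Completeness: the sum of an absolutely convergent series exists pointwise, and countable
subadditivity of costs controls its tails. -/
theorem completeSpace_convSpace [CompleteSpace Z] :
    @CompleteSpace (convAlgebra hτ mE hmE mZ hmZ hmul)
      (convRingNorm hτ mE hmE mZ hmZ hmul).toAddGroupNorm.toNormedAddCommGroup.toUniformSpace := by
  let := (convRingNorm hτ mE hmE mZ hmZ hmul).toAddGroupNorm.toNormedAddCommGroup
  refine NormedAddCommGroup.completeSpace_of_summable_imp_tendsto fun u hu => ?_
  have hu' : Summable fun n => convNorm τ (u n) := hu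
  have hpt : ∀ s, Summable fun n => (u n : ℝ → ℂ) s := fun s =>
    Summable.of_norm_bounded hu' fun n => norm_apply_le_convNorm hτ (u n).2 s
  let c : ℕ → ℝ := fun n => convNorm τ (u n) + (1 / 2) ^ n
  have hc : Summable c := hu'.add summable_geometric_two
  have hcost : ∀ n, CostLE τ (u n) (c n) := fun n => costLE_convNorm_add (u n).2 (by positivity)
  have htail : ∀ N, CostLE τ (fun s => ∑' n, (u (n + N) : ℝ → ℂ) s) (∑' n, c (n + N)) := fun N =>
    CostLE.hasSum hτ (fun n => hcost (n + N)) ((summable_nat_add_iff N).2 hc)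
      fun s => ((summable_nat_add_iff N).2 (hpt s)).hasSum
  let a : convAlgebra hτ mE hmE mZ hmZ hmul := ⟨fun s => ∑' n, (u n : ℝ → ℂ) s, (htail 0).mem⟩
  refine ⟨a, ?_⟩
  rw [tendsto_iff_norm_sub_tendsto_zero]
  refine squeeze_zero (fun _ => norm_nonneg _) (fun N => ?_) (tendsto_sum_nat_add c)
  rw [norm_sub_rev]
  have h1 : ((a - ∑ n ∈ Finset.range N, u n : convAlgebra hτ mE hmE mZ hmZ hmul) : ℝ → ℂ) =
      fun s => ∑' n, (u (n + N) : ℝ → ℂ) s := by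
    funext s
    have h2 : ((a - ∑ n ∈ Finset.range N, u n : convAlgebra hτ mE hmE mZ hmZ hmul) : ℝ → ℂ) s =
        (∑' n, (u n : ℝ → ℂ) s) - ∑ n ∈ Finset.range N, (u n : ℝ → ℂ) s := by
      simp [a]
    rw [h2, sub_eq_iff_eq_add']
    exact ((hpt s).sum_add_tsum_nat_add N).symm
  change convNorm τ
    ((a - ∑ n ∈ Finset.range N, u n : convAlgebra hτ mE hmE mZ hmZ hmul) : ℝ → ℂ) ≤ _
  rw [h1]
  exact (htail N).convNorm_le

end Generic

/-! ### The trace pairing -/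

theorem conv_eq_hardyConv (f : C₀(ℝ, SInf)) (h : hardy SOne) (s : ℝ) :
    conv f h s = hardyConv (tracePairing stdBasis) f h s := by
  have h1 := integral_sub_left_eq_self
    (fun t => tracePairing stdBasis (f (s - t)) ((h : Lp SOne 1 volume) t)) volume s
  rw [hardyConv, pairConv, ← h1]
  refine integral_congr_ae (Eventually.of_forall fun t => ?_)
  simp only [sub_sub_cancel]
  rfl

theorem represents_iff (F : ℝ → ℂ) (f : ℕ → C₀(ℝ, SInf)) (h : ℕ → hardy SOne) :
    Represents F f h ↔ IsRep (tracePairing stdBasis) F f h := by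
  simp only [Represents, IsRep, conv_eq_hardyConv]

theorem A0_eq_convSpace : A0 = convSpace (tracePairing stdBasis) := by
  simp only [A0, convSpace, represents_iff]

theorem A0norm_eq_convNorm (F : ℝ → ℂ) : A0norm F = convNorm (tracePairing stdBasis) F := by
  simp only [A0norm, convNorm, represents_iff]

end S1Hardy
end

/-- `𝒜_{0,S^1}(ℝ)` is a Banach algebra for the pointwise multiplication: it is a (non-unital)
subalgebra of the algebra of all functions `ℝ → ℂ`, on which the infimum norm is a submultiplicative,
complete algebra norm. -/
theorem proposition4p1 :
    ∃ (B : NonUnitalSubalgebra ℂ (ℝ → ℂ)) (N : RingNorm B),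
      (B : Set (ℝ → ℂ)) = S1Hardy.A0 ∧
      (∀ F : B, N F = S1Hardy.A0norm F) ∧
      (∀ (c : ℂ) (F : B), N (c • F) = ‖c‖ * N F) ∧
      @CompleteSpace B N.toAddGroupNorm.toNormedAddCommGroup.toUniformSpace :=
  ⟨S1Hardy.convAlgebra (S1Hardy.norm_tracePairing_le (b := S1Hardy.stdBasis))
      (S1Hardy.compactTensL S1Hardy.stdBasis) (S1Hardy.norm_compactTensL_le S1Hardy.stdBasis)
      (S1Hardy.traceTensL S1Hardy.stdBasis) (S1Hardy.norm_traceTensL_le S1Hardy.stdBasis)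
      (S1Hardy.tracePairing_tens S1Hardy.stdBasis),
    S1Hardy.convRingNorm _ _ _ _ _ _, S1Hardy.A0_eq_convSpace.symm,
    fun F => (S1Hardy.A0norm_eq_convNorm F).symm,
    fun c F => S1Hardy.convNorm_smul F.2 c, S1Hardy.completeSpace_convSpace _ _ _ _ _ _⟩
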